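/- Let $N\in\mathbb Z_{\ge0}$, $m\in\mathbb C$, and let $\Lambda_N=\mathbb C[x_1,\dots,x_N]^{S_N}$. *Cherednik algebra.* Let $H_m$ be the rational Cherednik algebra of $S_N$ with $t=1$: it is generated by $\mathbb C[x_1,\dots,x_N]$, $\mathbb C[y_1,\dots,y_N]$ and $\mathbb C S_N$ with the relations $w x_i=x_{w(i)}w$, $w y_i=y_{w(i)}w$, $y_ix_j-x_jy_i=m s_{ij}$ for $i\ne j$, and $y_ix_i-x_iy_i=1-m\sum_{k\neq i}s_{ik}$. It acts on $\mathbb C[x_1,\dots,x_N]$: $x_i$ acts by multiplication, $y_i$ by the Dunkl operator $D_i=\partial_i+m\sum_{j\ne i}\frac{1}{x_i-x_j}(s_{ij}-1)$, and $w\in S_N$ by permuting the variables. For $h\in H_m$ commuting with $S_N$, let $\mathrm{Res}\,h$ denote the $S_N$-invariant differential operator with rational coefficients that acts on $\Lambda_N$ in the same way as $h$. Let $\gamma$ be the automorphism $x_i\mapsto x_i-y_i$, $y_i\mapsto y_i$, $w\mapsto w$ of $H_m$. Put $\pi_i=x_iy_i$, let $\mathcal T\subset H_m$ be the subalgebra generated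 by $\sum_i\pi_i^k$, $k\ge0$, and let $\mathcal R=\gamma(\mathcal T)$. *Quantum integrals.* For $p\in\Lambda_N$ let $\mathcal L_p=\mathrm{Res}\,p(\pi_1,\dots,\pi_N)$. Since the $\pi_i$ do not commute, $p(\pi_1,\dots,\pi_N)$ stands for $P(\pi_1,\dots,\pi_N)$, where $P$ is a noncommutative polynomial of degree at most $\deg p$ that is invariant under permutations of the letters and becomes $p$ when the letters commute; everything below holds for every such choice. Let $L=\Delta-\sum_{i<j}\frac{2m}{x_i-x_j}(\partial_i-\partial_j)$ and $$\mathcal L_p^{\mathcal H}=\sum_{n=0}^{\deg p}\frac1{2^n n!}\,[\cdots[[\mathcal L_p,\underbrace{L],L],\dots,L}_{n}].$$ Let $\mathcal D^T_{CM}$ and $\mathcal D^R_{CM}$ be the algebras generated by all the operators $\mathcal L_p$ and by all the operators $\mathcal L_p^{\mathcal H}$, respectively, $p\in\Lambda_N$. **Proposition.** 1. For every $h\in H_m$ commuting with $S_N$, $\mathrm{Res}\,h$ exists and is unique. Each $p\in\Lambda_N$ admits a choice of $P$, and each such choice defines a unique operator $\mathcal L_p$. The algebra $\mathcal T$ is commutative,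 and $\mathcal R$ is generated by the elements $\sum_i(x_iy_i-y_i^2)^k$, $k\ge 0$. 2. $\mathrm{Res}$ gives surjective algebra homomorphisms $\mathcal T\to\mathcal D_{CM}^T$ and $\mathcal R\to\mathcal D^R_{CM}$, and there is an algebra homomorphism $\varphi_{LN}:\mathcal D_{CM}^T\to\mathcal D_{CM}^R$ with $\varphi_{LN}(\mathcal L_p)=\mathcal L_p^{\mathcal H}$ for all $p\in\Lambda_N$, such that $$\mathrm{Res}\circ\gamma|_{\mathcal T}=\varphi_{LN}\circ\mathrm{Res}|_{\mathcal T}.$$ 3. $\mathcal L_p^{\mathcal H}=e^{-L/2}\mathcal L_pe^{L/2}$ for all $p\in\Lambda_N$. Here both sides act on the space of all rational functions $f$ such that $L^nf=0$ for some $n$, on which the exponentials are given by finite sums; this space contains $\Lambda_N$ and is preserved by $\mathcal L_p$. -/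

import Mathlib

namespace LassalleNekrasov

noncomputable section

/-! ## Polynomials and rational functions in `x_1, …, x_N` -/

/-- The polynomial algebra `ℂ[x_1, …, x_N]`. -/
abbrev PolyC (N : ℕ) : Type := MvPolynomial (Fin N) ℂ

/-- The field of rational functions `ℂ(x_1, …, x_N)`. -/
abbrev RatFun (N : ℕ) : Type := FractionRing (PolyC N)

/-- The algebra `Λ_N = ℂ[x_1, …, x_N]^{S_N}` of symmetric polynomials. -/
abbrev symPoly (N : ℕ) : Subalgebra ℂ (PolyC N) := MvPolynomial.symmetricSubalgebra (Fin N) ℂ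

/-- The action of a permutation on polynomials: `(w p)(x) = p(w⁻¹ x)`, i.e. `x_i ↦ x_{w(i)}`. -/
def permOp {N : ℕ} (w : Equiv.Perm (Fin N)) : Module.End ℂ (PolyC N) :=
  (MvPolynomial.rename w : PolyC N →ₐ[ℂ] PolyC N).toLinearMap

theorem permOp_apply {N : ℕ} (w : Equiv.Perm (Fin N)) (p : PolyC N) :
    permOp w p = MvPolynomial.rename w p := rfl

theorem dvd_sub_swap {N : ℕ} (i j : Fin N) (p : PolyC N) :
    (MvPolynomial.X i - MvPolynomial.X j : PolyC N) ∣
      p - MvPolynomial.rename (Equiv.swap i j) p := by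
  induction p using MvPolynomial.induction_on with
  | C a => simp
  | add p q hp hq =>
    have : p + q - MvPolynomial.rename (Equiv.swap i j) (p + q) =
        (p - MvPolynomial.rename (Equiv.swap i j) p) +
          (q - MvPolynomial.rename (Equiv.swap i j) q) := by
      rw [map_add]; ring
    rw [this]
    exact dvd_add hp hq
  | mul_X p n hp =>
    have : p * MvPolynomial.X n - MvPolynomial.rename (Equiv.swap i j) (p * MvPolynomial.X n) =
        (p - MvPolynomial.rename (Equiv.swap i j) p) * MvPolynomial.X n +
          MvPolynomial.rename (Equiv.swap i j) p *
            (MvPolynomial.X n - MvPolynomial.X (Equiv.swap i j n)) := by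
      rw [map_mul, MvPolynomial.rename_X]; ring
    rw [this]
    refine dvd_add (hp.mul_right _) (Dvd.dvd.mul_left ?_ _)
    by_cases hi : n = i
    · subst hi; simp
    · by_cases hj : n = j
      · subst hj
        rw [Equiv.swap_apply_right]
        exact ⟨-1, by ring⟩
      · rw [Equiv.swap_apply_of_ne_of_ne hi hj]; simp

theorem X_sub_X_ne_zero {N : ℕ} {i j : Fin N} (h : i ≠ j) :
    (MvPolynomial.X i - MvPolynomial.X j : PolyC N) ≠ 0 := by
  rw [sub_ne_zero]
  exact fun e => h (MvPolynomial.X_injective e)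

/-- The divided difference `p ↦ (p - s_{ij} p) / (x_i - x_j)` for `i ≠ j` (and `0` for `i = j`). -/
def divDiff {N : ℕ} (i j : Fin N) : Module.End ℂ (PolyC N) :=
  if h : i = j then 0 else
  { toFun := fun p => (dvd_sub_swap i j p).choose
    map_add' := fun p q => by
      apply mul_left_cancel₀ (X_sub_X_ne_zero h)
      rw [mul_add, ← (dvd_sub_swap i j p).choose_spec, ← (dvd_sub_swap i j q).choose_spec,
        ← (dvd_sub_swap i j (p + q)).choose_spec, map_add]
      ring
    map_smul' := fun c p => by
      apply mul_left_cancel₀ (X_sub_X_ne_zero h)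
      rw [RingHom.id_apply, mul_smul_comm, ← (dvd_sub_swap i j p).choose_spec,
        ← (dvd_sub_swap i j (c • p)).choose_spec, map_smul, smul_sub] }

theorem divDiff_spec {N : ℕ} {i j : Fin N} (h : i ≠ j) (p : PolyC N) :
    (MvPolynomial.X i - MvPolynomial.X j) * divDiff i j p =
      p - MvPolynomial.rename (Equiv.swap i j) p := by
  rw [divDiff, dif_neg h]
  exact (dvd_sub_swap i j p).choose_spec.symm

/-- The Dunkl operator `D_i = ∂_i + m ∑_{j ≠ i} (x_i - x_j)⁻¹ (s_{ij} - 1)` on polynomials. -/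
def dunkl {N : ℕ} (m : ℂ) (i : Fin N) : Module.End ℂ (PolyC N) :=
  (MvPolynomial.pderiv i : Derivation ℂ (PolyC N) (PolyC N)).toLinearMap
    - m • ∑ j ∈ Finset.univ.erase i, divDiff i j

/-- Multiplication by the variable `x_i`. -/
def mulX {N : ℕ} (i : Fin N) : Module.End ℂ (PolyC N) :=
  LinearMap.mulLeft ℂ (MvPolynomial.X i : PolyC N)

/-! ### Relations between the operators above -/

theorem permOp_mul {N : ℕ} (v w : Equiv.Perm (Fin N)) :
    permOp v * permOp w = permOp (v * w) := by
  apply LinearMap.ext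
  intro p
  rw [Module.End.mul_apply, permOp_apply, permOp_apply, permOp_apply,
    MvPolynomial.rename_rename, Equiv.Perm.coe_mul]

theorem permOp_one {N : ℕ} : permOp (1 : Equiv.Perm (Fin N)) = 1 := by
  apply LinearMap.ext
  intro p
  rw [permOp_apply, Equiv.Perm.coe_one, MvPolynomial.rename_id_apply, Module.End.one_apply]

theorem permOp_mulX {N : ℕ} (w : Equiv.Perm (Fin N)) (i : Fin N) :
    permOp w * mulX i = mulX (w i) * permOp w := by
  apply LinearMap.ext
  intro p
  simp [permOp_apply, Module.End.mul_apply, mulX]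

theorem permOp_divDiff {N : ℕ} (w : Equiv.Perm (Fin N)) (i j : Fin N) :
    permOp w * divDiff i j = divDiff (w i) (w j) * permOp w := by
  by_cases h : i = j
  · subst h; simp [divDiff]
  · have h' : w i ≠ w j := fun e => h (w.injective e)
    apply LinearMap.ext
    intro p
    apply mul_left_cancel₀ (X_sub_X_ne_zero h')
    rw [Module.End.mul_apply, Module.End.mul_apply, divDiff_spec h', permOp_apply, permOp_apply]
    have := congrArg (MvPolynomial.rename w) (divDiff_spec h p)
    rw [map_mul, map_sub, MvPolynomial.rename_X, MvPolynomial.rename_X, map_sub,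
      MvPolynomial.rename_rename] at this
    rw [this, MvPolynomial.rename_rename]
    congr 2
    have e : w * Equiv.swap i j = Equiv.swap (w i) (w j) * w := by
      rw [Equiv.mul_swap_eq_swap_mul]
    have e' := congrArg (fun u : Equiv.Perm (Fin N) => (u : Fin N → Fin N)) e
    simp only [Equiv.Perm.coe_mul] at e'
    rw [e']

theorem permOp_pderiv {N : ℕ} (w : Equiv.Perm (Fin N)) (i : Fin N) :
    permOp w * (MvPolynomial.pderiv i : Derivation ℂ (PolyC N) (PolyC N)).toLinearMap =
      (MvPolynomial.pderiv (w i) : Derivation ℂ (PolyC N) (PolyC N)).toLinearMap * permOp w := by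
  apply LinearMap.ext
  intro p
  exact (MvPolynomial.pderiv_rename w.injective i p).symm

theorem permOp_dunkl {N : ℕ} (m : ℂ) (w : Equiv.Perm (Fin N)) (i : Fin N) :
    permOp w * dunkl m i = dunkl m (w i) * permOp w := by
  have key : ∑ j ∈ Finset.univ.erase i, permOp w * divDiff i j =
      ∑ j ∈ Finset.univ.erase (w i), divDiff (w i) j * permOp w := by
    refine Finset.sum_bij' (fun j _ => w j) (fun j _ => w.symm j) ?_ ?_ ?_ ?_ ?_
    · intro j hj
      simp only [Finset.mem_erase, Finset.mem_univ, and_true] at hj ⊢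
      exact fun e => hj (w.injective e)
    · intro j hj
      simp only [Finset.mem_erase, Finset.mem_univ, and_true] at hj ⊢
      intro e
      exact hj (by rw [← e, Equiv.apply_symm_apply])
    · intro j _; simp
    · intro j _; simp
    · intro j _; exact permOp_divDiff w i j
  rw [dunkl, dunkl, mul_sub, sub_mul, permOp_pderiv, mul_smul_comm, smul_mul_assoc,
    Finset.mul_sum, Finset.sum_mul, key]

theorem divDiff_mulX_of_ne {N : ℕ} {i j k : Fin N} (h : i ≠ j) (hi : k ≠ i) (hj : k ≠ j) :
    divDiff i j * mulX k - mulX k * divDiff i j = 0 := by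
  apply LinearMap.ext
  intro p
  apply mul_left_cancel₀ (X_sub_X_ne_zero h)
  simp only [LinearMap.sub_apply, Module.End.mul_apply, mulX, LinearMap.mulLeft_apply,
    LinearMap.zero_apply]
  rw [mul_sub, divDiff_spec h, mul_left_comm, divDiff_spec h, map_mul, MvPolynomial.rename_X,
    Equiv.swap_apply_of_ne_of_ne hi hj]
  ring

theorem divDiff_mulX_left {N : ℕ} {i j : Fin N} (h : i ≠ j) :
    divDiff i j * mulX i - mulX i * divDiff i j = permOp (Equiv.swap i j) := by
  apply LinearMap.ext
  intro p
  apply mul_left_cancel₀ (X_sub_X_ne_zero h)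
  simp only [LinearMap.sub_apply, Module.End.mul_apply, mulX, LinearMap.mulLeft_apply]
  rw [mul_sub, divDiff_spec h, mul_left_comm, divDiff_spec h, map_mul, MvPolynomial.rename_X,
    Equiv.swap_apply_left, permOp_apply]
  ring

theorem divDiff_mulX_right {N : ℕ} {i j : Fin N} (h : i ≠ j) :
    divDiff i j * mulX j - mulX j * divDiff i j = -permOp (Equiv.swap i j) := by
  apply LinearMap.ext
  intro p
  apply mul_left_cancel₀ (X_sub_X_ne_zero h)
  simp only [LinearMap.sub_apply, Module.End.mul_apply, mulX, LinearMap.mulLeft_apply,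
    LinearMap.neg_apply]
  rw [mul_sub, divDiff_spec h, mul_left_comm, divDiff_spec h, map_mul, MvPolynomial.rename_X,
    Equiv.swap_apply_right, permOp_apply]
  ring

theorem pderiv_mulX {N : ℕ} (i j : Fin N) :
    (MvPolynomial.pderiv i : Derivation ℂ (PolyC N) (PolyC N)).toLinearMap * mulX j
      - mulX j * (MvPolynomial.pderiv i : Derivation ℂ (PolyC N) (PolyC N)).toLinearMap =
      if i = j then 1 else 0 := by
  apply LinearMap.ext
  intro p
  change MvPolynomial.pderiv i (MvPolynomial.X j * p) -
    MvPolynomial.X j * MvPolynomial.pderiv i p = _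
  rw [Derivation.leibniz, MvPolynomial.pderiv_X]
  by_cases h : i = j
  · subst h; simp
  · simp [h, Ne.symm h]

/-- The commutator `[D_i, x_j]`, `i ≠ j`. -/
theorem dunkl_mulX_of_ne {N : ℕ} (m : ℂ) {i j : Fin N} (h : i ≠ j) :
    dunkl m i * mulX j - mulX j * dunkl m i = m • permOp (Equiv.swap i j) := by
  have e : dunkl m i * mulX j - mulX j * dunkl m i =
      ((MvPolynomial.pderiv i : Derivation ℂ (PolyC N) (PolyC N)).toLinearMap * mulX j
        - mulX j * (MvPolynomial.pderiv i : Derivation ℂ (PolyC N) (PolyC N)).toLinearMap)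
      - m • ∑ k ∈ Finset.univ.erase i, (divDiff i k * mulX j - mulX j * divDiff i k) := by
    rw [dunkl, sub_mul, mul_sub, smul_mul_assoc, mul_smul_comm, Finset.sum_mul, Finset.mul_sum,
      Finset.sum_sub_distrib, smul_sub]
    abel
  rw [e, pderiv_mulX, if_neg h,
    Finset.sum_eq_single_of_mem j (by simp [Ne.symm h]), divDiff_mulX_right h]
  · simp
  · intro k hk hkj
    simp only [Finset.mem_erase, Finset.mem_univ, and_true] at hk
    exact divDiff_mulX_of_ne (Ne.symm hk) (Ne.symm h) (Ne.symm hkj)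

/-- The commutator `[D_i, x_i]`. -/
theorem dunkl_mulX_self {N : ℕ} (m : ℂ) (i : Fin N) :
    dunkl m i * mulX i - mulX i * dunkl m i =
      1 - m • ∑ k ∈ Finset.univ.erase i, permOp (Equiv.swap i k) := by
  have e : dunkl m i * mulX i - mulX i * dunkl m i =
      ((MvPolynomial.pderiv i : Derivation ℂ (PolyC N) (PolyC N)).toLinearMap * mulX i
        - mulX i * (MvPolynomial.pderiv i : Derivation ℂ (PolyC N) (PolyC N)).toLinearMap)
      - m • ∑ k ∈ Finset.univ.erase i, (divDiff i k * mulX i - mulX i * divDiff i k) := by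
    rw [dunkl, sub_mul, mul_sub, smul_mul_assoc, mul_smul_comm, Finset.sum_mul, Finset.mul_sum,
      Finset.sum_sub_distrib, smul_sub]
    abel
  rw [e, pderiv_mulX, if_pos rfl]
  congr 2
  refine Finset.sum_congr rfl fun k hk => ?_
  simp only [Finset.mem_erase, Finset.mem_univ, and_true] at hk
  exact divDiff_mulX_left (Ne.symm hk)

theorem dunkl_one {N : ℕ} (m : ℂ) (i : Fin N) : dunkl m i (1 : PolyC N) = 0 := by
  have h : ∀ k ∈ Finset.univ.erase i, divDiff i k (1 : PolyC N) = 0 := by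
    intro k hk
    simp only [Finset.mem_erase, Finset.mem_univ, and_true] at hk
    apply mul_left_cancel₀ (X_sub_X_ne_zero (Ne.symm hk))
    rw [divDiff_spec (Ne.symm hk)]; simp
  rw [dunkl, LinearMap.sub_apply, LinearMap.smul_apply, LinearMap.sum_apply,
    Finset.sum_eq_zero h]
  simp

/-- The Dunkl operators commute. -/
theorem dunkl_comm {N : ℕ} (m : ℂ) (i j : Fin N) :
    dunkl (N := N) m i * dunkl m j = dunkl m j * dunkl m i := by
  by_cases hij : i = j
  · rw [hij]
  have hsub : ∀ A B : Module.End ℂ (PolyC N), m • (A - B) = m • A - m • B :=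
    fun A B => smul_sub m A B
  have swapComm : ∀ a b c : Fin N, a ≠ b → a ≠ c →
      dunkl m a * permOp (Equiv.swap b c) - permOp (Equiv.swap b c) * dunkl m a = 0 := by
    intro a b c hb hc
    rw [permOp_dunkl, Equiv.swap_apply_of_ne_of_ne hb hc, sub_self]
  have key : ∀ i j : Fin N, i ≠ j →
      (dunkl m i * (dunkl m j * mulX i - mulX i * dunkl m j)
          - (dunkl m j * mulX i - mulX i * dunkl m j) * dunkl m i)
        - (dunkl m j * (dunkl m i * mulX i - mulX i * dunkl m i)
          - (dunkl m i * mulX i - mulX i * dunkl m i) * dunkl m j) = 0 := by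
    intro i j hij
    rw [dunkl_mulX_of_ne m (Ne.symm hij), dunkl_mulX_self]
    have hj : j ∈ Finset.univ.erase i := by simp [Ne.symm hij]
    have h1 : dunkl m j * (1 - m • ∑ k ∈ Finset.univ.erase i, permOp (Equiv.swap i k))
          - (1 - m • ∑ k ∈ Finset.univ.erase i, permOp (Equiv.swap i k)) * dunkl m j =
        - (m • ∑ k ∈ Finset.univ.erase i,
          (dunkl m j * permOp (Equiv.swap i k) - permOp (Equiv.swap i k) * dunkl m j)) := by
      rw [mul_sub, sub_mul, mul_one, one_mul, mul_smul_comm, smul_mul_assoc, Finset.mul_sum,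
        Finset.sum_mul, Finset.sum_sub_distrib, smul_sub]
      abel
    rw [h1, Finset.sum_eq_single_of_mem j hj]
    · rw [permOp_dunkl, Equiv.swap_apply_right, Equiv.swap_comm j i, mul_smul_comm,
        smul_mul_assoc, permOp_dunkl, Equiv.swap_apply_left, smul_sub]
      abel
    · intro k hk hkj
      exact swapComm j i k (Ne.symm hij) (Ne.symm hkj)
  have comm : ∀ k : Fin N,
      (dunkl m i * dunkl m j - dunkl m j * dunkl m i) * mulX k =
        mulX k * (dunkl m i * dunkl m j - dunkl m j * dunkl m i) := by
    intro k
    have jac : (dunkl m i * dunkl m j - dunkl m j * dunkl m i) * mulX k -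
        mulX k * (dunkl m i * dunkl m j - dunkl m j * dunkl m i) =
        (dunkl m i * (dunkl m j * mulX k - mulX k * dunkl m j)
          - (dunkl m j * mulX k - mulX k * dunkl m j) * dunkl m i)
        - (dunkl m j * (dunkl m i * mulX k - mulX k * dunkl m i)
          - (dunkl m i * mulX k - mulX k * dunkl m i) * dunkl m j) := by
      simp only [mul_sub, sub_mul, mul_assoc]
      abel
    rw [← sub_eq_zero, jac]
    by_cases hki : k = i
    · subst hki; exact key k j hij
    · by_cases hkj : k = j
      · subst hkj
        rw [← neg_eq_zero, neg_sub]
        exact key k i (Ne.symm hij)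
      · rw [dunkl_mulX_of_ne m (Ne.symm hkj), dunkl_mulX_of_ne m (Ne.symm hki),
          mul_smul_comm, smul_mul_assoc, mul_smul_comm, smul_mul_assoc, ← hsub, ← hsub,
          swapComm i j k hij (Ne.symm hki), swapComm j i k (Ne.symm hij) (Ne.symm hkj)]
        simp
  rw [← sub_eq_zero]
  apply LinearMap.ext
  intro p
  induction p using MvPolynomial.induction_on with
  | C a =>
    have : (MvPolynomial.C a : PolyC N) = a • 1 := by
      rw [MvPolynomial.smul_eq_C_mul, mul_one]
    rw [this, map_smul]
    simp [Module.End.mul_apply, dunkl_one]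
  | add p q hp hq => rw [map_add, hp, hq]; simp
  | mul_X p n hp =>
    have h := LinearMap.congr_fun (comm n) p
    simp only [Module.End.mul_apply, mulX, LinearMap.mulLeft_apply] at h
    rw [mul_comm p, h, hp]
    simp

/-! ## The rational Cherednik algebra of `S_N` with parameters `t = 1` and `m` -/

/-- Generators of the rational Cherednik algebra: `x_i`, `y_i` and the elements of `S_N`. -/
inductive Gen (N : ℕ) : Type
  | x (i : Fin N) : Gen N
  | y (i : Fin N) : Gen N
  | w (σ : Equiv.Perm (Fin N)) : Gen N

/-- The free algebra on these generators. -/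
abbrev FreeGen (N : ℕ) : Type := FreeAlgebra ℂ (Gen N)

/-- A generator, as an element of the free algebra. -/
def gen {N : ℕ} (g : Gen N) : FreeGen N := FreeAlgebra.ι ℂ g

/-- The defining relations: the `x_i` generate a polynomial ring, the `y_i` generate a polynomial
ring, the `w ∈ S_N` generate the group algebra, `w p(x) = p(w⁻¹ x) w`, `w q(y) = q(w⁻¹ y) w`, and
`y_i x_j - x_j y_i = S_{ij}` with `S_{ij} = m s_{ij}` (`i ≠ j`),
`S_{ii} = 1 - m ∑_{k ≠ i} s_{ik}`. -/
inductive CherednikRel (N : ℕ) (m : ℂ) : FreeGen N → FreeGen N → Prop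
  | xx (i j : Fin N) : CherednikRel N m (gen (.x i) * gen (.x j)) (gen (.x j) * gen (.x i))
  | yy (i j : Fin N) : CherednikRel N m (gen (.y i) * gen (.y j)) (gen (.y j) * gen (.y i))
  | one : CherednikRel N m (gen (.w 1)) 1
  | mul (v w : Equiv.Perm (Fin N)) :
      CherednikRel N m (gen (.w v) * gen (.w w)) (gen (.w (v * w)))
  | wx (w : Equiv.Perm (Fin N)) (i : Fin N) :
      CherednikRel N m (gen (.w w) * gen (.x i)) (gen (.x (w i)) * gen (.w w))
  | wy (w : Equiv.Perm (Fin N)) (i : Fin N) :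
      CherednikRel N m (gen (.w w) * gen (.y i)) (gen (.y (w i)) * gen (.w w))
  | yx (i j : Fin N) (h : i ≠ j) :
      CherednikRel N m (gen (.y i) * gen (.x j) - gen (.x j) * gen (.y i))
        (m • gen (.w (Equiv.swap i j)))
  | yxSelf (i : Fin N) :
      CherednikRel N m (gen (.y i) * gen (.x i) - gen (.x i) * gen (.y i))
        (1 - m • ∑ k ∈ Finset.univ.erase i, gen (.w (Equiv.swap i k)))

/-- The rational Cherednik algebra `H_m`. -/
def Cherednik (N : ℕ) (m : ℂ) : Type := RingQuot (CherednikRel N m)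

instance (N : ℕ) (m : ℂ) : Ring (Cherednik N m) :=
  inferInstanceAs (Ring (RingQuot (CherednikRel N m)))

instance (N : ℕ) (m : ℂ) : Algebra ℂ (Cherednik N m) :=
  inferInstanceAs (Algebra ℂ (RingQuot (CherednikRel N m)))

/-- The quotient map from the free algebra onto `H_m`. -/
def Hmk (N : ℕ) (m : ℂ) : FreeGen N →ₐ[ℂ] Cherednik N m :=
  RingQuot.mkAlgHom ℂ (CherednikRel N m)

theorem Hmk_rel {N : ℕ} {m : ℂ} {a b : FreeGen N} (h : CherednikRel N m a b) :
    Hmk N m a = Hmk N m b := RingQuot.mkAlgHom_rel ℂ h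

/-- The class of a generator in `H_m`. -/
def Hgen {N : ℕ} (m : ℂ) (g : Gen N) : Cherednik N m :=
  Hmk N m (gen g)

/-- The element `x_i` of `H_m`. -/
def Hx {N : ℕ} (m : ℂ) (i : Fin N) : Cherednik N m := Hgen m (.x i)

/-- The element `y_i` of `H_m`. -/
def Hy {N : ℕ} (m : ℂ) (i : Fin N) : Cherednik N m := Hgen m (.y i)

/-- The element `w ∈ S_N` of `H_m`. -/
def Hw {N : ℕ} (m : ℂ) (w : Equiv.Perm (Fin N)) : Cherednik N m := Hgen m (.w w)

section relations

set_option linter.unusedSimpArgs false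

variable {N : ℕ} (m : ℂ)

theorem Hx_comm (i j : Fin N) : Hx m i * Hx m j = Hx m j * Hx m i := by
  have h := Hmk_rel (CherednikRel.xx (m := m) i j)
  simp only [map_mul, map_sub, map_one, map_smul, map_sum] at h
  exact h

theorem Hy_comm (i j : Fin N) : Hy m i * Hy m j = Hy m j * Hy m i := by
  have h := Hmk_rel (CherednikRel.yy (m := m) i j)
  simp only [map_mul, map_sub, map_one, map_smul, map_sum] at h
  exact h

theorem Hw_one : Hw m (1 : Equiv.Perm (Fin N)) = 1 := by
  have h := Hmk_rel (CherednikRel.one (N := N) (m := m))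
  simp only [map_mul, map_sub, map_one, map_smul, map_sum] at h
  exact h

theorem Hw_mul (v w : Equiv.Perm (Fin N)) : Hw m v * Hw m w = Hw m (v * w) := by
  have h := Hmk_rel (CherednikRel.mul (m := m) v w)
  simp only [map_mul, map_sub, map_one, map_smul, map_sum] at h
  exact h

theorem Hw_Hx (w : Equiv.Perm (Fin N)) (i : Fin N) :
    Hw m w * Hx m i = Hx m (w i) * Hw m w := by
  have h := Hmk_rel (CherednikRel.wx (m := m) w i)
  simp only [map_mul, map_sub, map_one, map_smul, map_sum] at h
  exact h

theorem Hw_Hy (w : Equiv.Perm (Fin N)) (i : Fin N) :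
    Hw m w * Hy m i = Hy m (w i) * Hw m w := by
  have h := Hmk_rel (CherednikRel.wy (m := m) w i)
  simp only [map_mul, map_sub, map_one, map_smul, map_sum] at h
  exact h

theorem Hy_Hx_of_ne {i j : Fin N} (hij : i ≠ j) :
    Hy m i * Hx m j - Hx m j * Hy m i = m • Hw m (Equiv.swap i j) := by
  have h := Hmk_rel (CherednikRel.yx (m := m) i j hij)
  simp only [map_mul, map_sub, map_one, map_smul, map_sum] at h
  exact h

theorem Hy_Hx_self (i : Fin N) :
    Hy m i * Hx m i - Hx m i * Hy m i =
      1 - m • ∑ k ∈ Finset.univ.erase i, Hw m (Equiv.swap i k) := by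
  have h := Hmk_rel (CherednikRel.yxSelf (m := m) i)
  simp only [map_mul, map_sub, map_one, map_smul, map_sum] at h
  exact h

/-- Universal property of `H_m`: images of the generators satisfying the relations. -/
def Hlift {A : Type*} [Ring A] [Algebra ℂ A] (f : Gen N → A)
    (h : ∀ ⦃a b⦄, CherednikRel N m a b → FreeAlgebra.lift ℂ f a = FreeAlgebra.lift ℂ f b) :
    Cherednik N m →ₐ[ℂ] A :=
  RingQuot.liftAlgHom ℂ ⟨FreeAlgebra.lift ℂ f, h⟩

theorem Hlift_gen {A : Type*} [Ring A] [Algebra ℂ A] (f : Gen N → A)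
    (h : ∀ ⦃a b⦄, CherednikRel N m a b → FreeAlgebra.lift ℂ f a = FreeAlgebra.lift ℂ f b)
    (g : Gen N) : Hlift m f h (Hgen m g) = f g := by
  have e : Hlift m f h (Hgen m g) = FreeAlgebra.lift ℂ f (gen g) :=
    RingQuot.liftAlgHom_mkAlgHom_apply ℂ (FreeAlgebra.lift ℂ f) h (gen g)
  rw [e, gen, FreeAlgebra.lift_ι_apply]

theorem Hom_ext {A : Type*} [Ring A] [Algebra ℂ A] {f g : Cherednik N m →ₐ[ℂ] A}
    (hx : ∀ i, f (Hx m i) = g (Hx m i)) (hy : ∀ i, f (Hy m i) = g (Hy m i))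
    (hw : ∀ w, f (Hw m w) = g (Hw m w)) : f = g := by
  apply RingQuot.ringQuot_ext'
  apply FreeAlgebra.hom_ext
  funext a
  cases a with
  | x i => exact hx i
  | y i => exact hy i
  | w σ => exact hw σ

theorem Hy_pow_Hx {i j : Fin N} (h : i ≠ j) (l : ℕ) :
    Hy m i ^ l * Hx m j - Hx m j * Hy m i ^ l =
      (m • ∑ a ∈ Finset.range l, Hy m i ^ a * Hy m j ^ (l - 1 - a)) *
        Hw m (Equiv.swap i j) := by
  induction l with
  | zero => simp
  | succ l ih =>
    have hs : ∀ l : ℕ, Hw m (Equiv.swap i j) * Hy m i ^ l =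
        Hy m j ^ l * Hw m (Equiv.swap i j) := by
      intro l
      induction l with
      | zero => simp
      | succ l ih =>
        rw [pow_succ, ← mul_assoc, ih, mul_assoc, Hw_Hy, Equiv.swap_apply_left, ← mul_assoc,
          ← pow_succ]
    have e : Hy m i ^ (l + 1) * Hx m j - Hx m j * Hy m i ^ (l + 1) =
        Hy m i * (Hy m i ^ l * Hx m j - Hx m j * Hy m i ^ l) +
          (Hy m i * Hx m j - Hx m j * Hy m i) * Hy m i ^ l := by
      rw [pow_succ']; simp only [mul_sub, sub_mul, mul_assoc]; abel
    rw [e, ih, Hy_Hx_of_ne m h, smul_mul_assoc m (Hw m _), hs, Finset.sum_range_succ']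
    simp only [pow_zero, one_mul, Nat.add_sub_cancel, Nat.sub_zero]
    have hsum : Hy m i * ∑ a ∈ Finset.range l, Hy m i ^ a * Hy m j ^ (l - 1 - a) =
        ∑ a ∈ Finset.range l, Hy m i ^ (a + 1) * Hy m j ^ (l - (a + 1)) := by
      rw [Finset.mul_sum]
      refine Finset.sum_congr rfl fun a _ => ?_
      rw [← mul_assoc, ← pow_succ', Nat.sub_sub, add_comm 1 a]
    rw [← mul_assoc, mul_smul_comm, hsum, smul_add, add_mul, smul_mul_assoc m (Hy m j ^ l)]

end relations

/-- Images of the generators under the polynomial representation. -/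
def polyRepGen {N : ℕ} (m : ℂ) : Gen N → Module.End ℂ (PolyC N)
  | .x i => mulX i
  | .y i => dunkl m i
  | .w σ => permOp σ

/-- The polynomial representation `ρ : H_m → End(ℂ[x])`: `x_i` acts by multiplication, `y_i` by the
Dunkl operator `D_i`, and `w ∈ S_N` by permutation of the variables. -/
def polyRep (N : ℕ) (m : ℂ) : Cherednik N m →ₐ[ℂ] Module.End ℂ (PolyC N) :=
  Hlift m (polyRepGen m) (by
    intro a b h
    cases h with
    | xx i j =>
      simp only [gen, map_mul, FreeAlgebra.lift_ι_apply, polyRepGen]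
      apply LinearMap.ext
      intro p
      simp only [Module.End.mul_apply, mulX, LinearMap.mulLeft_apply]
      ring
    | yy i j =>
      simp only [gen, map_mul, FreeAlgebra.lift_ι_apply, polyRepGen]
      exact dunkl_comm m i j
    | one => simp only [gen, map_one, FreeAlgebra.lift_ι_apply, polyRepGen, permOp_one]
    | mul v w => simp only [gen, map_mul, FreeAlgebra.lift_ι_apply, polyRepGen, permOp_mul]
    | wx w i => simp only [gen, map_mul, FreeAlgebra.lift_ι_apply, polyRepGen, permOp_mulX]
    | wy w i => simp only [gen, map_mul, FreeAlgebra.lift_ι_apply, polyRepGen, permOp_dunkl]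
    | yx i j h =>
      simp only [gen, map_mul, map_sub, map_smul, FreeAlgebra.lift_ι_apply, polyRepGen]
      exact dunkl_mulX_of_ne m h
    | yxSelf i =>
      simp only [gen, map_mul, map_sub, map_smul, map_sum, map_one, FreeAlgebra.lift_ι_apply,
        polyRepGen]
      exact dunkl_mulX_self m i)

/-- Images of the generators under `a_{τ,l}`. -/
def shearGen {N : ℕ} (m τ : ℂ) (l : ℕ) : Gen N → Cherednik N m
  | .x i => Hx m i + τ • Hy m i ^ l
  | .y i => Hy m i
  | .w σ => Hw m σ

/-- The endomorphism `x_i ↦ x_i + τ y_i^l`, `y_i ↦ y_i`, `w ↦ w` of `H_m`. -/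
def shearHom (N : ℕ) (m τ : ℂ) (l : ℕ) : Cherednik N m →ₐ[ℂ] Cherednik N m :=
  Hlift m (shearGen m τ l) (by
    intro a b h
    have hc : ∀ i j : Fin N, Hy m i * Hy m j ^ l = Hy m j ^ l * Hy m i := fun i j =>
      ((show Commute (Hy m i) (Hy m j) from Hy_comm m i j).pow_right l).eq
    cases h with
    | xx i j =>
      simp only [gen, map_mul, FreeAlgebra.lift_ι_apply, shearGen]
      by_cases hij : i = j
      · rw [hij]
      have h1 := Hy_pow_Hx m hij l
      have h2 := Hy_pow_Hx m (Ne.symm hij) l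
      rw [Equiv.swap_comm j i] at h2
      have hg : ∑ a ∈ Finset.range l, Hy m i ^ a * Hy m j ^ (l - 1 - a) =
          ∑ a ∈ Finset.range l, Hy m j ^ a * Hy m i ^ (l - 1 - a) :=
        (show Commute (Hy m i) (Hy m j) from Hy_comm m i j).geom_sum₂_comm l
      rw [hg, ← h2] at h1
      have hyy : Hy m i ^ l * Hy m j ^ l = Hy m j ^ l * Hy m i ^ l :=
        ((show Commute (Hy m i) (Hy m j) from Hy_comm m i j).pow_pow l l).eq
      have h3 : Hx m i * Hy m j ^ l + Hy m i ^ l * Hx m j =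
          Hx m j * Hy m i ^ l + Hy m j ^ l * Hx m i := by
        have h4 := sub_eq_sub_iff_add_eq_add.mp h1
        rw [add_comm, h4, add_comm]
      have e : ∀ i j : Fin N,
          (Hx m i + τ • Hy m i ^ l) * (Hx m j + τ • Hy m j ^ l) =
          Hx m i * Hx m j + τ • (Hx m i * Hy m j ^ l + Hy m i ^ l * Hx m j)
            + (τ * τ) • (Hy m i ^ l * Hy m j ^ l) := by
        intro i j
        simp only [mul_add, add_mul, smul_mul_assoc, mul_smul_comm, smul_add, smul_smul]
        abel
      rw [e i j, e j i, h3, Hx_comm m i j, hyy]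
    | yy i j =>
      simp only [gen, map_mul, FreeAlgebra.lift_ι_apply, shearGen]
      exact Hy_comm m i j
    | one => simp only [gen, map_one, FreeAlgebra.lift_ι_apply, shearGen, Hw_one]
    | mul v w => simp only [gen, map_mul, FreeAlgebra.lift_ι_apply, shearGen, Hw_mul]
    | wx w i =>
      simp only [gen, map_mul, FreeAlgebra.lift_ι_apply, shearGen]
      have hs : ∀ l : ℕ, Hw m w * Hy m i ^ l = Hy m (w i) ^ l * Hw m w := by
        intro l
        induction l with
        | zero => simp
        | succ l ih => rw [pow_succ, ← mul_assoc, ih, mul_assoc, Hw_Hy, ← mul_assoc, ← pow_succ]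
      rw [mul_add, add_mul, Hw_Hx, mul_smul_comm, smul_mul_assoc, hs]
    | wy w i => simp only [gen, map_mul, FreeAlgebra.lift_ι_apply, shearGen, Hw_Hy]
    | yx i j h =>
      simp only [gen, map_mul, map_sub, map_smul, FreeAlgebra.lift_ι_apply, shearGen]
      rw [← Hy_Hx_of_ne m h, mul_add, add_mul, mul_smul_comm, smul_mul_assoc, hc]
      abel
    | yxSelf i =>
      simp only [gen, map_mul, map_sub, map_smul, map_sum, map_one, FreeAlgebra.lift_ι_apply,
        shearGen]
      rw [← Hy_Hx_self m i, mul_add, add_mul, mul_smul_comm, smul_mul_assoc, hc]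
      abel)

theorem shearHom_Hx {N : ℕ} (m τ : ℂ) (l : ℕ) (i : Fin N) :
    shearHom N m τ l (Hx m i) = Hx m i + τ • Hy m i ^ l := Hlift_gen ..

theorem shearHom_Hy {N : ℕ} (m τ : ℂ) (l : ℕ) (i : Fin N) :
    shearHom N m τ l (Hy m i) = Hy m i := Hlift_gen ..

theorem shearHom_Hw {N : ℕ} (m τ : ℂ) (l : ℕ) (w : Equiv.Perm (Fin N)) :
    shearHom N m τ l (Hw m w) = Hw m w := Hlift_gen ..

theorem shearHom_comp {N : ℕ} (m τ : ℂ) (l : ℕ) :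
    (shearHom N m τ l).comp (shearHom N m (-τ) l) = AlgHom.id ℂ (Cherednik N m) := by
  apply Hom_ext
  · intro i
    simp only [AlgHom.comp_apply, shearHom_Hx, shearHom_Hy, map_add, map_smul, map_pow,
      AlgHom.id_apply, add_assoc]
    rw [neg_smul, add_neg_cancel, add_zero]
  · intro i; simp only [AlgHom.comp_apply, shearHom_Hy, AlgHom.id_apply]
  · intro w; simp only [AlgHom.comp_apply, shearHom_Hw, AlgHom.id_apply]

/-- The automorphism `a_{τ,l}` of `H_m`: `x_i ↦ x_i + τ y_i^l`, `y_i ↦ y_i`, `w ↦ w`. -/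
def shear (N : ℕ) (m τ : ℂ) (l : ℕ) : Cherednik N m ≃ₐ[ℂ] Cherednik N m :=
  AlgEquiv.ofAlgHom (shearHom N m τ l) (shearHom N m (-τ) l) (shearHom_comp m τ l)
    (by simpa using shearHom_comp (N := N) m (-τ) l)

/-- The automorphism `γ = a_{-1,1}` of `H_m`: `x_i ↦ x_i - y_i`, `y_i ↦ y_i`, `w ↦ w`. -/
def gammaAut (N : ℕ) (m : ℂ) : Cherednik N m ≃ₐ[ℂ] Cherednik N m := shear N m (-1) 1

/-- The elements `π_i = x_i y_i` of `H_m`. -/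
def Hpi {N : ℕ} (m : ℂ) (i : Fin N) : Cherednik N m := Hx m i * Hy m i

/-- The subalgebra `𝒯` of `H_m` generated by the elements `π^k = ∑_i π_i^k`, `k ≥ 0`. -/
def algT (N : ℕ) (m : ℂ) : Subalgebra ℂ (Cherednik N m) :=
  Algebra.adjoin ℂ (Set.range fun k : ℕ => ∑ i : Fin N, Hpi m i ^ k)

/-- The subalgebra `ℛ = γ(𝒯)` of `H_m`. -/
def algR (N : ℕ) (m : ℂ) : Subalgebra ℂ (Cherednik N m) :=
  (algT N m).map (gammaAut N m : Cherednik N m →ₐ[ℂ] Cherednik N m)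

/-! ## Differential operators with rational coefficients -/

/-- The homomorphism `f(x) ↦ f(x + ε e_i) = f + ε ∂_i f` to dual numbers over `ℂ(x)`. -/
def taylorPoly {N : ℕ} (i : Fin N) : PolyC N →ₐ[ℂ] DualNumber (RatFun N) :=
  MvPolynomial.aeval fun j =>
    TrivSqZeroExt.inl (algebraMap (PolyC N) (RatFun N) (MvPolynomial.X j)) +
      TrivSqZeroExt.inr (Pi.single i 1 j)

theorem fst_taylorPoly {N : ℕ} (i : Fin N) (p : PolyC N) :
    (taylorPoly i p).fst = algebraMap (PolyC N) (RatFun N) p := by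
  have : (TrivSqZeroExt.fstHom ℂ (RatFun N) (RatFun N)).comp (taylorPoly i) =
      IsScalarTower.toAlgHom ℂ (PolyC N) (RatFun N) := by
    apply MvPolynomial.algHom_ext
    intro j
    simp [taylorPoly]
  exact DFunLike.congr_fun this p

theorem snd_taylorPoly {N : ℕ} (i : Fin N) (p : PolyC N) :
    (taylorPoly i p).snd = algebraMap (PolyC N) (RatFun N) (MvPolynomial.pderiv i p) := by
  induction p using MvPolynomial.induction_on with
  | C a =>
    have : (MvPolynomial.C a : PolyC N) = algebraMap ℂ (PolyC N) a := rfl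
    rw [this, AlgHom.commutes]
    simp [TrivSqZeroExt.algebraMap_eq_inl']
  | add p q hp hq => simp [hp, hq]
  | mul_X p n hp =>
    have hX : (taylorPoly i (MvPolynomial.X n)).snd =
        algebraMap (PolyC N) (RatFun N) (MvPolynomial.pderiv i (MvPolynomial.X n)) := by
      rw [taylorPoly, MvPolynomial.aeval_X, TrivSqZeroExt.snd_add, TrivSqZeroExt.snd_inl,
        TrivSqZeroExt.snd_inr, zero_add, MvPolynomial.pderiv_X]
      by_cases h : n = i
      · subst h; simp
      · simp [h]
    rw [map_mul, DualNumber.snd_mul, hp, hX, fst_taylorPoly, fst_taylorPoly, Derivation.leibniz,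
      smul_eq_mul, smul_eq_mul, map_add, map_mul, map_mul]
    ring

/-- The extension of `taylorPoly` to rational functions. -/
def taylorRat {N : ℕ} (i : Fin N) : RatFun N →ₐ[ℂ] DualNumber (RatFun N) :=
  IsLocalization.liftAlgHom (M := nonZeroDivisors (PolyC N)) (f := taylorPoly i) (by
    intro p
    rw [TrivSqZeroExt.isUnit_iff_isUnit_fst]
    have h : (taylorPoly i (p : PolyC N)).fst = _ := fst_taylorPoly i p
    rw [h]
    exact IsLocalization.map_units (RatFun N) p)

theorem taylorRat_algebraMap {N : ℕ} (i : Fin N) (p : PolyC N) :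
    taylorRat i (algebraMap (PolyC N) (RatFun N) p) = taylorPoly i p := by
  rw [taylorRat, IsLocalization.liftAlgHom_apply, IsLocalization.lift_eq]
  rfl

theorem fst_taylorRat {N : ℕ} (i : Fin N) (f : RatFun N) : (taylorRat i f).fst = f := by
  have : ((TrivSqZeroExt.fstHom ℂ (RatFun N) (RatFun N)).comp (taylorRat i)).toRingHom =
      RingHom.id (RatFun N) := by
    apply IsLocalization.ringHom_ext (nonZeroDivisors (PolyC N))
    apply RingHom.ext
    intro p
    simp only [RingHom.comp_apply, AlgHom.toRingHom_eq_coe, RingHom.coe_coe, AlgHom.comp_apply,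
      taylorRat_algebraMap, TrivSqZeroExt.fstHom_apply, fst_taylorPoly, RingHom.id_apply]
  exact DFunLike.congr_fun this f

/-- The partial derivative `∂_i` on rational functions. -/
def ratDeriv {N : ℕ} (i : Fin N) : Derivation ℂ (RatFun N) (RatFun N) :=
  Derivation.mk'
    { toFun := fun f => (taylorRat i f).snd
      map_add' := fun f g => by simp
      map_smul' := fun c f => by simp }
    (fun f g => by
      simp only [LinearMap.coe_mk, AddHom.coe_mk, map_mul, DualNumber.snd_mul, fst_taylorRat,
        smul_eq_mul]
      ring)

theorem ratDeriv_algebraMap {N : ℕ} (i : Fin N) (p : PolyC N) :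
    ratDeriv i (algebraMap (PolyC N) (RatFun N) p) =
      algebraMap (PolyC N) (RatFun N) (MvPolynomial.pderiv i p) := by
  rw [← snd_taylorPoly, ← taylorRat_algebraMap]
  rfl

/-- The operator `∂_i` on rational functions. -/
def dOp {N : ℕ} (i : Fin N) : Module.End ℂ (RatFun N) := (ratDeriv i).toLinearMap

/-- The coordinate `x_i` as a rational function. -/
def ratX {N : ℕ} (i : Fin N) : RatFun N := algebraMap (PolyC N) (RatFun N) (MvPolynomial.X i)

/-- The algebra of differential operators with rational coefficients: generated by the
multiplications by rational functions and the derivatives `∂_i`. -/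
def diffOps (N : ℕ) : Subalgebra ℂ (Module.End ℂ (RatFun N)) :=
  Algebra.adjoin ℂ (Set.range (LinearMap.mulLeft ℂ : RatFun N → Module.End ℂ (RatFun N)) ∪
    Set.range (dOp : Fin N → Module.End ℂ (RatFun N)))

/-- The action of a permutation on rational functions. -/
def ratPerm {N : ℕ} (w : Equiv.Perm (Fin N)) : RatFun N ≃ₐ[ℂ] RatFun N :=
  IsFractionRing.algEquivOfAlgEquiv (MvPolynomial.renameEquiv ℂ w)

/-- `S_N`-invariance of an operator on rational functions. -/
def IsInvariantOp {N : ℕ} (D : Module.End ℂ (RatFun N)) : Prop :=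
  ∀ (w : Equiv.Perm (Fin N)) (f : RatFun N), D (ratPerm w f) = ratPerm w (D f)

/-- `D = Res h`: `D` is an `S_N`-invariant differential operator with rational coefficients which
acts on the symmetric polynomials in the same way as `h ∈ H_m` does in the polynomial
representation. -/
structure IsRes {N : ℕ} (m : ℂ) (h : Cherednik N m) (D : Module.End ℂ (RatFun N)) : Prop where
  mem_diffOps : D ∈ diffOps N
  invariant : IsInvariantOp D
  restrict : ∀ q ∈ symPoly N,
    D (algebraMap (PolyC N) (RatFun N) q) = algebraMap (PolyC N) (RatFun N) (polyRep N m h q)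

/-- The rational Calogero–Moser operator
`L = Δ - ∑_{i < j} 2m / (x_i - x_j) (∂_i - ∂_j)`. -/
def opL (N : ℕ) (m : ℂ) : Module.End ℂ (RatFun N) :=
  ∑ i : Fin N, dOp i * dOp i
    - ∑ i : Fin N, ∑ j ∈ Finset.univ.filter (fun j => i < j),
        LinearMap.mulLeft ℂ (algebraMap ℂ (RatFun N) (2 * m) / (ratX i - ratX j))
          * (dOp i - dOp j)

/-! ## The quantum integrals -/

/-- `P` is an ordering of the symmetric polynomial `p`: a polynomial in noncommuting letters, of
degree at most `deg p`, which is invariant under permutations of the letters and becomes `p` when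
the letters commute. The letters have to be ordered because the `π_i` do not commute. -/
structure IsOrdering {N : ℕ} (p : PolyC N) (P : FreeAlgebra ℂ (Fin N)) : Prop where
  lifts : FreeAlgebra.lift ℂ (fun i => (MvPolynomial.X i : PolyC N)) P = p
  invariant : ∀ w : Equiv.Perm (Fin N),
    FreeAlgebra.lift ℂ (fun i => FreeAlgebra.ι ℂ (w i)) P = P
  degree_le : P ∈ Submodule.span ℂ {u : FreeAlgebra ℂ (Fin N) |
    ∃ s : List (Fin N), s.length ≤ p.totalDegree ∧ u = (s.map (FreeAlgebra.ι ℂ)).prod}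

/-- The value `P(π_1, …, π_N) ∈ H_m` of a noncommutative polynomial. -/
def evalPi {N : ℕ} (m : ℂ) (P : FreeAlgebra ℂ (Fin N)) : Cherednik N m :=
  FreeAlgebra.lift ℂ (Hpi m) P

/-- `D = 𝓛_p`: `D` is an `S_N`-invariant differential operator which acts on symmetric polynomials
as `p(π_1, …, π_N)`, for some ordering of `p`. -/
def IsTrigIntegral {N : ℕ} (m : ℂ) (p : PolyC N) (D : Module.End ℂ (RatFun N)) : Prop :=
  ∃ P : FreeAlgebra ℂ (Fin N), IsOrdering p P ∧ IsRes m (evalPi m P) D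

/-- The iterated commutator `[⋯[[D, L], L], ⋯, L]` with `n` brackets. -/
def iterComm {V : Type*} [AddCommGroup V] [Module ℂ V] (L D : Module.End ℂ V) (n : ℕ) :
    Module.End ℂ V :=
  (fun X => X * L - L * X)^[n] D

/-- The sum `D + (1/2) [D, L] + ⋯ + (1/(2^d d!)) [⋯[D, L], ⋯, L]` for the rational Calogero–Moser
operator `L`. For `D = 𝓛_p` and `d = deg p` it is `𝓛_p^ℋ`. -/
def harmonicOp {N : ℕ} (m : ℂ) (d : ℕ) (D : Module.End ℂ (RatFun N)) :
    Module.End ℂ (RatFun N) :=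
  ∑ n ∈ Finset.range (d + 1), (1 / (2 ^ n * (n.factorial : ℂ))) • iterComm (opL N m) D n

/-- The algebra `𝒟_CM^T` generated by the operators `𝓛_p`, `p ∈ Λ_N`. -/
def algDT (N : ℕ) (m : ℂ) : Subalgebra ℂ (Module.End ℂ (RatFun N)) :=
  Algebra.adjoin ℂ {D | ∃ p ∈ symPoly N, IsTrigIntegral m p D}

/-- The algebra `𝒟_CM^R` generated by the operators `𝓛_p^ℋ`, `p ∈ Λ_N`. -/
def algDR (N : ℕ) (m : ℂ) : Subalgebra ℂ (Module.End ℂ (RatFun N)) :=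
  Algebra.adjoin ℂ {D' | ∃ p ∈ symPoly N, ∃ D, IsTrigIntegral m p D ∧
    D' = harmonicOp m p.totalDegree D}

/-- `A^n f = 0` for some `n`, so that the exponential series of `A` at `f` is a finite sum. -/
def LocNilpotent {V : Type*} [AddCommGroup V] [Module ℂ V] (A : Module.End ℂ V) (f : V) : Prop :=
  ∃ n : ℕ, (A ^ n) f = 0

/-- The exponential `e^A f = ∑_n A^n f / n!`, for `f` at which `A` is locally nilpotent. -/
def locExp {V : Type*} [AddCommGroup V] [Module ℂ V] (A : Module.End ℂ V) (f : V) : V :=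
  ∑ᶠ n : ℕ, (1 / (n.factorial : ℂ)) • (A ^ n) f

end

end LassalleNekrasov

open LassalleNekrasov

namespace LassalleNekrasov

noncomputable section

/-! ## The elements `π_i` -/

/-! The automorphism `γ` is the exponential of an inner derivation. Put `Y = ∑ y_i^2` (`HLap`) and
`δ(h) = ½(hY - Yh)` (`halfComm`). In `H_m` the reflection terms of `[Y, x_i]` cancel, so `δ(x_i) =
-y_i`, while `δ` kills every `y_i` and `w`. Hence `δ` is locally nilpotent and `e^δ = γ`
(`gammaAut_eq_locExp`). On symmetric polynomials `Y` acts as the Calogero–Moser operator `L`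
(`isRes_opL`), and `Res` is an algebra homomorphism on the commutant of `S_N`; therefore `Res γ(h)`
is the exponential of `D ↦ ½[D, L]` at `D = Res h` (`IsRes.gammaAut`). This exponential is `φ_LN`.
Each `π_i` is killed by `δ^2`, so words of length at most `d` are killed by `δ^(d+1)` and the series
at `𝓛_p` ends at `n = deg p`. The Leibniz rule for the pairing `(D, f) ↦ D f` identifies it with
conjugation by `e^{L/2}` (`locExp_halfComm_apply`).

Two further points are needed. `Res` must be well defined: a differential operator vanishing on
`Λ_N` is zero (`diffOps_ext`), by induction on the order, because `ℂ(x)` has no nonzero derivation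
that kills the symmetric polynomials. Existence holds because a permutation acting after an operator
`E` on `Λ_N` is a conjugate of `E`.

Secondly, every ordering of `p` must give an operator in `Res(𝒯)`. The relation `[π_i, π_j] = m(π_i
- π_j)s_ij` shows that a reordering changes the action on `Λ_N` only by terms of lower degree, and
induction on the degree applies (`exists_algT_action`). The same relation gives a formula for
`[π_i^k, π_j^l]` symmetric in `k, l`, whence `𝒯` is commutative. -/

theorem Hw_mul_Hpi {N : ℕ} (m : ℂ) (w : Equiv.Perm (Fin N)) (i : Fin N) :
    Hw m w * Hpi m i = Hpi m (w i) * Hw m w := by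
  rw [Hpi, Hpi, ← mul_assoc, Hw_Hx, mul_assoc, Hw_Hy, ← mul_assoc]

theorem Hw_mul_Hpi_pow {N : ℕ} (m : ℂ) (w : Equiv.Perm (Fin N)) (i : Fin N) (k : ℕ) :
    Hw m w * Hpi m i ^ k = Hpi m (w i) ^ k * Hw m w := by
  induction k with
  | zero => simp
  | succ k ih => rw [pow_succ, ← mul_assoc, ih, mul_assoc, Hw_mul_Hpi, ← mul_assoc, ← pow_succ]

/-- The commutator `[π_i, π_j]`. -/
theorem Hpi_commutator {N : ℕ} (m : ℂ) (i j : Fin N) :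
    Hpi m i * Hpi m j - Hpi m j * Hpi m i =
      m • ((Hpi m i - Hpi m j) * Hw m (Equiv.swap i j)) := by
  by_cases h : i = j
  · subst h; simp
  have h1 := Hy_Hx_of_ne m h
  have h2 := Hy_Hx_of_ne m (Ne.symm h)
  rw [Equiv.swap_comm j i] at h2
  -- The quartic terms `x_i x_j y_i y_j` cancel; only the mixed commutators remain.
  have e : Hpi m i * Hpi m j - Hpi m j * Hpi m i =
      Hx m i * (Hy m i * Hx m j - Hx m j * Hy m i) * Hy m j
        - Hx m j * (Hy m j * Hx m i - Hx m i * Hy m j) * Hy m i := by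
    have e1 : Hx m i * Hx m j * (Hy m i * Hy m j) = Hx m j * Hx m i * (Hy m j * Hy m i) := by
      rw [Hx_comm m i j, Hy_comm m i j]
    simp only [Hpi, mul_sub, sub_mul]
    simp only [mul_assoc] at e1 ⊢
    rw [e1]; abel
  have e3 : Hw m (Equiv.swap i j) * Hy m j = Hy m i * Hw m (Equiv.swap i j) := by
    rw [Hw_Hy, Equiv.swap_apply_right]
  have e4 : Hw m (Equiv.swap i j) * Hy m i = Hy m j * Hw m (Equiv.swap i j) := by
    rw [Hw_Hy, Equiv.swap_apply_left]
  rw [e, h1, h2]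
  simp only [mul_smul_comm, smul_mul_assoc, mul_assoc, e3, e4, ← smul_sub, Hpi, sub_mul]

theorem Hpi_commutator_pow {N : ℕ} (m : ℂ) (i j : Fin N) (l : ℕ) :
    Hpi m i * Hpi m j ^ l - Hpi m j ^ l * Hpi m i =
      m • ((Hpi m i ^ l - Hpi m j ^ l) * Hw m (Equiv.swap i j)) := by
  induction l with
  | zero => simp
  | succ l ih =>
    have e : Hpi m i * Hpi m j ^ (l + 1) - Hpi m j ^ (l + 1) * Hpi m i =
        (Hpi m i * Hpi m j ^ l - Hpi m j ^ l * Hpi m i) * Hpi m j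
          + Hpi m j ^ l * (Hpi m i * Hpi m j - Hpi m j * Hpi m i) := by
      rw [pow_succ]; simp only [mul_sub, sub_mul, mul_assoc]; abel
    have e3 : Hw m (Equiv.swap i j) * Hpi m j = Hpi m i * Hw m (Equiv.swap i j) := by
      rw [Hw_mul_Hpi, Equiv.swap_apply_right]
    rw [e, ih, Hpi_commutator, smul_mul_assoc, mul_assoc, e3, mul_smul_comm, ← smul_add]
    congr 1
    rw [← mul_assoc, ← mul_assoc, ← add_mul, pow_succ, pow_succ]
    congr 1
    simp only [sub_mul, mul_sub]; abel

/-- The commutator of powers of `π_i` and `π_j`, in a form symmetric in the two exponents. -/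
theorem Hpi_pow_commutator_pow {N : ℕ} (m : ℂ) (i j : Fin N) (k l : ℕ) :
    Hpi m i ^ k * Hpi m j ^ l - Hpi m j ^ l * Hpi m i ^ k =
      m • ((∑ a ∈ Finset.range (k + l), Hpi m i ^ a * Hpi m j ^ (k + l - 1 - a)
        - ∑ a ∈ Finset.range l, Hpi m i ^ a * Hpi m j ^ (k + l - 1 - a)
        - ∑ a ∈ Finset.range k, Hpi m i ^ a * Hpi m j ^ (k + l - 1 - a))
          * Hw m (Equiv.swap i j)) := by
  induction k with
  | zero => simp
  | succ k ih =>
    have e : Hpi m i ^ (k + 1) * Hpi m j ^ l - Hpi m j ^ l * Hpi m i ^ (k + 1) =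
        Hpi m i * (Hpi m i ^ k * Hpi m j ^ l - Hpi m j ^ l * Hpi m i ^ k)
          + (Hpi m i * Hpi m j ^ l - Hpi m j ^ l * Hpi m i) * Hpi m i ^ k := by
      rw [pow_succ']; simp only [mul_sub, sub_mul, mul_assoc]; abel
    have e3 : Hw m (Equiv.swap i j) * Hpi m i ^ k = Hpi m j ^ k * Hw m (Equiv.swap i j) := by
      rw [Hw_mul_Hpi_pow, Equiv.swap_apply_left]
    have shift : ∀ n : ℕ, Hpi m i * ∑ a ∈ Finset.range n, Hpi m i ^ a * Hpi m j ^ (k + l - 1 - a) =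
        ∑ a ∈ Finset.range n, Hpi m i ^ (a + 1) * Hpi m j ^ (k + 1 + l - 1 - (a + 1)) := by
      intro n
      rw [Finset.mul_sum]
      refine Finset.sum_congr rfl fun a _ => ?_
      rw [← mul_assoc, ← pow_succ']
      congr 2
      omega
    rw [e, ih, Hpi_commutator_pow, smul_mul_assoc, mul_assoc _ (Hw m _), e3, mul_smul_comm,
      ← smul_add, ← mul_assoc, ← mul_assoc, ← add_mul, mul_sub, mul_sub, shift, shift, shift]
    congr 2
    -- After the shift the three sums miss their boundary terms, which add up to `π_i^l π_j^k -
    -- π_j^(k+l)`. This is what the second summand of `e` contributes.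
    have e4 : k + 1 + l = (k + l) + 1 := by ring
    have s1 := Finset.sum_range_succ'
      (fun a => Hpi m i ^ a * Hpi m j ^ (k + 1 + l - 1 - a)) (k + l)
    have s2 := Finset.sum_range_succ'
      (fun a => Hpi m i ^ a * Hpi m j ^ (k + 1 + l - 1 - a)) l
    have s3 := Finset.sum_range_succ'
      (fun a => Hpi m i ^ a * Hpi m j ^ (k + 1 + l - 1 - a)) k
    have s4 := Finset.sum_range_succ
      (fun a => Hpi m i ^ a * Hpi m j ^ (k + 1 + l - 1 - a)) l
    rw [s4] at s2
    have e5 : k + 1 + l - 1 - l = k := by omega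
    have e6 : k + 1 + l - 1 - 0 = k + l := by omega
    rw [e5, e6, pow_zero, one_mul] at s2
    rw [e6, pow_zero, one_mul] at s1 s3
    have e7 : Finset.range (k + 1 + l) = Finset.range (k + l + 1) := by rw [e4]
    rw [e7, s1, s3, ← sub_eq_of_eq_add s2, sub_mul, ← pow_add, add_comm l k]
    abel

/-- The power sums in the `π_i` commute. -/
theorem powerSum_Hpi_comm {N : ℕ} (m : ℂ) (k l : ℕ) :
    (∑ i : Fin N, Hpi m i ^ k) * (∑ i : Fin N, Hpi m i ^ l) =
      (∑ i : Fin N, Hpi m i ^ l) * (∑ i : Fin N, Hpi m i ^ k) := by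
  have expand : ∀ k l : ℕ, (∑ i : Fin N, Hpi m i ^ k) * (∑ i : Fin N, Hpi m i ^ l) -
      (∑ i : Fin N, Hpi m i ^ l) * (∑ i : Fin N, Hpi m i ^ k) =
      ∑ i : Fin N, ∑ j : Fin N, (Hpi m i ^ k * Hpi m j ^ l - Hpi m j ^ l * Hpi m i ^ k) := by
    intro k l
    simp only [Finset.sum_sub_distrib, ← Finset.mul_sum, ← Finset.sum_mul]
  -- Each `[π_i^k, π_j^l]` is unchanged when `k` and `l` are exchanged, so the commutator of the two
  -- power sums equals its own negative.
  have symm : (∑ i : Fin N, Hpi m i ^ k) * (∑ i : Fin N, Hpi m i ^ l) -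
      (∑ i : Fin N, Hpi m i ^ l) * (∑ i : Fin N, Hpi m i ^ k) =
      (∑ i : Fin N, Hpi m i ^ l) * (∑ i : Fin N, Hpi m i ^ k) -
      (∑ i : Fin N, Hpi m i ^ k) * (∑ i : Fin N, Hpi m i ^ l) := by
    rw [expand, expand]
    refine Finset.sum_congr rfl fun i _ => Finset.sum_congr rfl fun j _ => ?_
    rw [Hpi_pow_commutator_pow, Hpi_pow_commutator_pow, add_comm l k, sub_right_comm]
  rw [← neg_sub, neg_eq_iff_add_eq_zero, ← two_smul ℂ, smul_eq_zero] at symm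
  exact (sub_eq_zero.mp (symm.resolve_left two_ne_zero)).symm

theorem algT_comm {N : ℕ} (m : ℂ) {a b : Cherednik N m} (ha : a ∈ algT N m)
    (hb : b ∈ algT N m) : a * b = b * a := by
  have h : ∀ x ∈ Set.range fun k : ℕ => ∑ i : Fin N, Hpi m i ^ k,
      ∀ y ∈ Set.range fun k : ℕ => ∑ i : Fin N, Hpi m i ^ k, x * y = y * x := by
    rintro _ ⟨k, rfl⟩ _ ⟨l, rfl⟩
    exact powerSum_Hpi_comm m k l
  exact congrArg Subtype.val
    ((Algebra.isMulCommutative_adjoin ℂ h).is_comm.comm ⟨a, ha⟩ ⟨b, hb⟩)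

theorem algR_eq_adjoin (N : ℕ) (m : ℂ) :
    algR N m = Algebra.adjoin ℂ (Set.range fun k : ℕ => ∑ i : Fin N,
      (Hx m i * Hy m i - Hy m i ^ 2) ^ k) := by
  rw [algR, algT, AlgHom.map_adjoin, ← Set.range_comp]
  congr 2
  funext k
  change gammaAut N m (∑ i, Hpi m i ^ k) = _
  rw [map_sum]
  refine Finset.sum_congr rfl fun i _ => ?_
  have h : gammaAut N m (Hpi m i) = Hx m i * Hy m i - Hy m i ^ 2 := by
    change shearHom N m (-1) 1 (Hx m i * Hy m i) = _
    rw [map_mul, shearHom_Hx, shearHom_Hy, pow_one, neg_smul, one_smul, ← sub_eq_add_neg, sub_mul,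
      sq]
  rw [map_pow, h]

/-! ## Elements commuting with the symmetric group -/

/-- The subalgebra of the elements of `H_m` commuting with `S_N`. -/
def invariantSubalgebra (N : ℕ) (m : ℂ) : Subalgebra ℂ (Cherednik N m) :=
  Subalgebra.centralizer ℂ (Set.range (Hw m : Equiv.Perm (Fin N) → Cherednik N m))

theorem mem_invariantSubalgebra {N : ℕ} {m : ℂ} {h : Cherednik N m} :
    h ∈ invariantSubalgebra N m ↔ ∀ w : Equiv.Perm (Fin N), Hw m w * h = h * Hw m w := by
  simp [invariantSubalgebra, Subalgebra.mem_centralizer_iff]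

theorem Hw_mul_evalPi {N : ℕ} (m : ℂ) (w : Equiv.Perm (Fin N)) (P : FreeAlgebra ℂ (Fin N)) :
    Hw m w * evalPi m P =
      evalPi m (FreeAlgebra.lift ℂ (fun i => FreeAlgebra.ι ℂ (w i)) P) * Hw m w := by
  induction P using FreeAlgebra.induction with
  | grade0 r => simp only [evalPi, AlgHom.commutes]; exact (Algebra.commutes r _).symm
  | grade1 i => simp only [evalPi, FreeAlgebra.lift_ι_apply, Hw_mul_Hpi]
  | mul a b ha hb =>
    simp only [evalPi, map_mul] at ha hb ⊢
    rw [← mul_assoc, ha, mul_assoc, hb, ← mul_assoc]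
  | add a b ha hb =>
    simp only [evalPi, map_add] at ha hb ⊢
    rw [mul_add, ha, hb, ← add_mul]

theorem evalPi_mem_invariantSubalgebra {N : ℕ} (m : ℂ) {P : FreeAlgebra ℂ (Fin N)}
    (hP : ∀ w : Equiv.Perm (Fin N),
      FreeAlgebra.lift ℂ (fun i => FreeAlgebra.ι ℂ (w i)) P = P) :
    evalPi m P ∈ invariantSubalgebra N m := by
  rw [mem_invariantSubalgebra]
  intro w
  rw [Hw_mul_evalPi, hP]

theorem sum_comp_mem_invariantSubalgebra {N : ℕ} {m : ℂ} {f : Fin N → Cherednik N m}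
    (hf : ∀ w i, Hw m w * f i = f (w i) * Hw m w) :
    ∑ i, f i ∈ invariantSubalgebra N m := by
  rw [mem_invariantSubalgebra]
  intro w
  rw [Finset.mul_sum, Finset.sum_mul, ← Equiv.sum_comp w (fun i => f i * Hw m w)]
  exact Finset.sum_congr rfl fun i _ => hf w i

theorem algT_le_invariantSubalgebra (N : ℕ) (m : ℂ) : algT N m ≤ invariantSubalgebra N m := by
  refine Algebra.adjoin_le ?_
  rintro _ ⟨k, rfl⟩
  exact sum_comp_mem_invariantSubalgebra fun w i => Hw_mul_Hpi_pow m w i k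

theorem gammaAut_mem_invariantSubalgebra {N : ℕ} {m : ℂ} {h : Cherednik N m}
    (hh : h ∈ invariantSubalgebra N m) : gammaAut N m h ∈ invariantSubalgebra N m := by
  rw [mem_invariantSubalgebra] at hh ⊢
  intro w
  have hw : gammaAut N m (Hw m w) = Hw m w := shearHom_Hw ..
  have := congrArg (gammaAut N m) (hh w)
  rwa [map_mul, map_mul, hw] at this

theorem algR_le_invariantSubalgebra (N : ℕ) (m : ℂ) : algR N m ≤ invariantSubalgebra N m := by
  rintro _ ⟨t, ht, rfl⟩
  exact gammaAut_mem_invariantSubalgebra (algT_le_invariantSubalgebra N m ht)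

/-- The element `∑ y_i^2` of `H_m`. -/
def HLap (N : ℕ) (m : ℂ) : Cherednik N m := ∑ i : Fin N, Hy m i ^ 2

theorem HLap_mem_invariantSubalgebra (N : ℕ) (m : ℂ) :
    HLap N m ∈ invariantSubalgebra N m :=
  sum_comp_mem_invariantSubalgebra fun w i => by
    rw [sq, ← mul_assoc, Hw_Hy, mul_assoc, Hw_Hy, ← mul_assoc, ← sq]

theorem HLap_Hy (m : ℂ) {N : ℕ} (i : Fin N) : HLap N m * Hy m i = Hy m i * HLap N m := by
  rw [HLap, Finset.sum_mul, Finset.mul_sum]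
  refine Finset.sum_congr rfl fun k _ => ?_
  exact ((show Commute (Hy m k) (Hy m i) from Hy_comm m k i).pow_left 2).eq

/-- The term `k = i` of the sum gives `2y_i - m ∑ (y_i + y_k)s_ik`, and each `k ≠ i` gives `m(y_k +
y_i)s_ik`, so the reflections cancel. -/
theorem HLap_Hx (m : ℂ) {N : ℕ} (i : Fin N) :
    HLap N m * Hx m i - Hx m i * HLap N m = (2 : ℂ) • Hy m i := by
  have hd : ∀ k : Fin N, Hy m k ^ 2 * Hx m i - Hx m i * Hy m k ^ 2 =
      Hy m k * (Hy m k * Hx m i - Hx m i * Hy m k)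
        + (Hy m k * Hx m i - Hx m i * Hy m k) * Hy m k := by
    intro k; rw [sq]; simp only [mul_sub, sub_mul, mul_assoc]; abel
  have ho : ∀ k ∈ Finset.univ.erase i, Hy m k ^ 2 * Hx m i - Hx m i * Hy m k ^ 2 =
      m • ((Hy m k + Hy m i) * Hw m (Equiv.swap i k)) := by
    intro k hk
    simp only [Finset.mem_erase, Finset.mem_univ, and_true] at hk
    rw [hd, Hy_Hx_of_ne m hk, mul_smul_comm, smul_mul_assoc, Hw_Hy, Equiv.swap_apply_left,
      ← smul_add, ← add_mul, Equiv.swap_comm]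
  rw [HLap, Finset.sum_mul, Finset.mul_sum, ← Finset.sum_sub_distrib,
    ← Finset.add_sum_erase _ _ (Finset.mem_univ i), hd, Hy_Hx_self, Finset.sum_congr rfl ho,
    mul_sub, sub_mul, mul_one, one_mul, mul_smul_comm, smul_mul_assoc, Finset.mul_sum,
    Finset.sum_mul]
  have hs : ∀ k : Fin N, Hw m (Equiv.swap i k) * Hy m i = Hy m k * Hw m (Equiv.swap i k) := by
    intro k; rw [Hw_Hy, Equiv.swap_apply_left]
  simp only [hs, add_mul, Finset.sum_add_distrib, smul_add, ← Finset.smul_sum, two_smul]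
  abel

/-! ## Locally finite exponentials -/

section LocExp

variable {V V₁ V₂ V₃ : Type*} [AddCommGroup V] [Module ℂ V] [AddCommGroup V₁] [Module ℂ V₁]
  [AddCommGroup V₂] [Module ℂ V₂] [AddCommGroup V₃] [Module ℂ V₃]

theorem pow_apply_eq_zero_of_le {A : Module.End ℂ V} {f : V} {K n : ℕ} (h : (A ^ K) f = 0)
    (hn : K ≤ n) : (A ^ n) f = 0 := by
  rw [← Nat.sub_add_cancel hn, pow_add, Module.End.mul_apply, h, map_zero]

/-- Exponents are kept in the form `a + 1`, so that `a + 1` and `b + 1` combine to `a + b + 1` under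
a Leibniz rule. -/
theorem LocNilpotent.exists_succ {A : Module.End ℂ V} {f : V} (h : LocNilpotent A f) :
    ∃ n, (A ^ (n + 1)) f = 0 :=
  let ⟨n, hn⟩ := h
  ⟨n, pow_apply_eq_zero_of_le hn n.le_succ⟩

theorem locExp_eq_sum {A : Module.End ℂ V} {f : V} {K : ℕ} (h : (A ^ K) f = 0) :
    locExp A f = ∑ n ∈ Finset.range K, (1 / (n.factorial : ℂ)) • (A ^ n) f := by
  refine finsum_eq_sum_of_support_subset _ fun n hn => ?_
  rw [Finset.coe_range, Set.mem_Iio]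
  by_contra hK
  exact hn (by simp only; rw [pow_apply_eq_zero_of_le h (not_lt.mp hK), smul_zero])

theorem LocNilpotent.smul {A : Module.End ℂ V} {f : V} (h : LocNilpotent A f) (c : ℂ) :
    LocNilpotent (c • A) f :=
  let ⟨n, hn⟩ := h
  ⟨n, by rw [smul_pow, LinearMap.smul_apply, hn, smul_zero]⟩

theorem locNilpotent_smul_iff {A : Module.End ℂ V} {f : V} {c : ℂ} (hc : c ≠ 0) :
    LocNilpotent (c • A) f ↔ LocNilpotent A f :=
  ⟨fun h => by simpa [smul_smul, inv_mul_cancel₀ hc] using h.smul c⁻¹, fun h => h.smul c⟩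

theorem LocNilpotent.add {A : Module.End ℂ V} {f g : V} (hf : LocNilpotent A f)
    (hg : LocNilpotent A g) : LocNilpotent A (f + g) := by
  obtain ⟨a, ha⟩ := hf
  obtain ⟨b, hb⟩ := hg
  refine ⟨max a b, ?_⟩
  rw [map_add, pow_apply_eq_zero_of_le ha (le_max_left a b),
    pow_apply_eq_zero_of_le hb (le_max_right a b), add_zero]

theorem locExp_add {A : Module.End ℂ V} {f g : V} (hf : LocNilpotent A f)
    (hg : LocNilpotent A g) : locExp A (f + g) = locExp A f + locExp A g := by
  obtain ⟨a, ha⟩ := hf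
  obtain ⟨b, hb⟩ := hg
  have ha' := pow_apply_eq_zero_of_le ha (le_max_left a b)
  have hb' := pow_apply_eq_zero_of_le hb (le_max_right a b)
  rw [locExp_eq_sum ha', locExp_eq_sum hb',
    locExp_eq_sum (K := max a b) (by rw [map_add, ha', hb', add_zero]), ← Finset.sum_add_distrib]
  exact Finset.sum_congr rfl fun n _ => by rw [map_add, smul_add]

theorem locExp_of_apply_eq_zero {A : Module.End ℂ V} {f : V} (h : A f = 0) :
    locExp A f = f := by
  rw [locExp_eq_sum (K := 1) (by simpa using h)]
  simp

theorem pow_commute_apply_eq_zero {A B : Module.End ℂ V} (hAB : Commute A B) {f : V} {a b : ℕ}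
    (ha : (A ^ (a + 1)) f = 0) (hb : (B ^ (b + 1)) f = 0) {k l : ℕ} (h : a < k ∨ b < l) :
    (A ^ k) ((B ^ l) f) = 0 := by
  rcases h with h | h
  · rw [← Module.End.mul_apply, (hAB.pow_pow k l).eq, Module.End.mul_apply,
      pow_apply_eq_zero_of_le ha h, map_zero]
  · rw [pow_apply_eq_zero_of_le hb h, map_zero]

/-- The binomial theorem with divided powers, in which the binomial coefficients disappear. -/
theorem pow_add_apply {A B : Module.End ℂ V} (hAB : Commute A B) (f : V) (n : ℕ) :
    (1 / (n.factorial : ℂ)) • ((A + B) ^ n) f = ∑ x ∈ Finset.HasAntidiagonal.antidiagonal n,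
      (1 / (x.1.factorial : ℂ)) • (1 / (x.2.factorial : ℂ)) • (A ^ x.1) ((B ^ x.2) f) := by
  rw [hAB.add_pow', LinearMap.sum_apply, Finset.smul_sum]
  refine Finset.sum_congr rfl fun x hx => ?_
  have hx' : x.1 + x.2 = n := Finset.HasAntidiagonal.mem_antidiagonal.mp hx
  rw [LinearMap.smul_apply, Module.End.mul_apply, ← Nat.cast_smul_eq_nsmul ℂ, smul_smul, smul_smul]
  congr 1
  have h := Nat.add_choose_mul_factorial_mul_factorial x.1 x.2
  rw [hx', ← Nat.choose_symm_of_eq_add hx'.symm] at h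
  have h' : (n.choose x.1 : ℂ) * x.1.factorial * x.2.factorial = n.factorial := by
    exact_mod_cast h
  have h1 : (x.1.factorial : ℂ) ≠ 0 := by exact_mod_cast x.1.factorial_ne_zero
  have h2 : (x.2.factorial : ℂ) ≠ 0 := by exact_mod_cast x.2.factorial_ne_zero
  have h3 : (n.factorial : ℂ) ≠ 0 := by exact_mod_cast n.factorial_ne_zero
  field_simp
  rw [← h']

theorem pow_add_apply_eq_zero {A B : Module.End ℂ V} (hAB : Commute A B) {f : V} {a b : ℕ}
    (ha : (A ^ (a + 1)) f = 0) (hb : (B ^ (b + 1)) f = 0) :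
    ((A + B) ^ (a + b + 1)) f = 0 := by
  have h := pow_add_apply hAB f (a + b + 1)
  rw [Finset.sum_eq_zero] at h
  · exact (smul_eq_zero.mp h).resolve_left
      (one_div_ne_zero (by exact_mod_cast (a + b + 1).factorial_ne_zero))
  · intro x hx
    rw [Finset.HasAntidiagonal.mem_antidiagonal] at hx
    rw [pow_commute_apply_eq_zero hAB ha hb (by omega), smul_zero, smul_zero]

/-- The rectangle of pairs `(k, l)` is cut along the antidiagonals `k + l = n`. The pairs of an
antidiagonal that fall outside the rectangle contribute zero. -/
theorem locExp_add_of_commute {A B : Module.End ℂ V} (hAB : Commute A B) {f : V} {a b : ℕ}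
    (ha : (A ^ (a + 1)) f = 0) (hb : (B ^ (b + 1)) f = 0) :
    locExp (A + B) f = ∑ k ∈ Finset.range (a + 1), ∑ l ∈ Finset.range (b + 1),
      (1 / (k.factorial : ℂ)) • (1 / (l.factorial : ℂ)) • (A ^ k) ((B ^ l) f) := by
  rw [locExp_eq_sum (pow_add_apply_eq_zero hAB ha hb), ← Finset.sum_product',
    ← Finset.sum_fiberwise_of_maps_to (s := Finset.range (a + 1) ×ˢ Finset.range (b + 1))
      (t := Finset.range (a + b + 1)) (g := fun x => x.1 + x.2)]
  · refine Finset.sum_congr rfl fun n _ => ?_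
    rw [pow_add_apply hAB]
    symm
    apply Finset.sum_subset
    · intro x hx
      rw [Finset.HasAntidiagonal.mem_antidiagonal]
      exact (Finset.mem_filter.mp hx).2
    · intro x hx hx'
      rw [Finset.HasAntidiagonal.mem_antidiagonal] at hx
      simp only [Finset.mem_filter, Finset.mem_product, Finset.mem_range, hx, and_true] at hx'
      rw [pow_commute_apply_eq_zero hAB ha hb (by omega), smul_zero, smul_zero]
  · intro x hx
    simp only [Finset.mem_product, Finset.mem_range] at hx ⊢
    omega

/-- `e^{-A} e^A = 1` on the vectors at which `A` is locally nilpotent. -/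
theorem locExp_neg_locExp {A : Module.End ℂ V} {f : V} (h : LocNilpotent A f) :
    locExp (-A) (locExp A f) = f := by
  obtain ⟨a, ha⟩ := h.exists_succ
  have hneg : ∀ {g : V}, (A ^ (a + 1)) g = 0 → ((-A) ^ (a + 1)) g = 0 := by
    intro g hg
    rw [neg_pow, Module.End.mul_apply, hg, map_zero]
  -- The exponents `-A` and `A` add up to zero, so this double sum is `f`.
  have h1 := locExp_add_of_commute (show Commute (-A) A from (Commute.refl A).neg_left)
    (hneg ha) ha
  rw [neg_add_cancel, locExp_of_apply_eq_zero (LinearMap.zero_apply f)] at h1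
  -- The same power of `A` kills `locExp A f`, so both exponentials are cut at the length of the
  -- double sum.
  have h2 : (A ^ (a + 1)) (locExp A f) = 0 := by
    rw [locExp_eq_sum ha, map_sum]
    refine Finset.sum_eq_zero fun n _ => ?_
    rw [map_smul, ← Module.End.mul_apply, ← pow_add, add_comm, pow_add, Module.End.mul_apply, ha,
      map_zero, smul_zero]
  rw [locExp_eq_sum (hneg h2), locExp_eq_sum ha]
  conv_rhs => rw [h1]
  refine Finset.sum_congr rfl fun k _ => ?_
  rw [map_sum, Finset.smul_sum]
  exact Finset.sum_congr rfl fun l _ => by rw [map_smul]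

/-! ### Exponentials of operators obeying a Leibniz rule -/

section Bilinear

variable {A₁ : Module.End ℂ V₁} {A₂ : Module.End ℂ V₂} {A₃ : Module.End ℂ V₃}
  {B : V₁ →ₗ[ℂ] V₂ →ₗ[ℂ] V₃}

/-- The Leibniz rule says that `TensorProduct.lift B` intertwines `A₃` with `A₁ ⊗ 1 + 1 ⊗ A₂`. The
two summands commute, which reduces products of exponentials to `locExp_add_of_commute`. -/
theorem pow_lift_tmul (hB : ∀ u v, A₃ (B u v) = B (A₁ u) v + B u (A₂ v)) (n : ℕ)
    (w : TensorProduct ℂ V₁ V₂) :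
    (A₃ ^ n) (TensorProduct.lift B w) =
      TensorProduct.lift B (((A₁.rTensor V₂ + A₂.lTensor V₁) ^ n) w) := by
  have h : A₃ ∘ₗ TensorProduct.lift B =
      TensorProduct.lift B ∘ₗ (A₁.rTensor V₂ + A₂.lTensor V₁) := by
    apply TensorProduct.ext'
    intro u v
    simp [hB]
  induction n with
  | zero => simp
  | succ n ih =>
    rw [pow_succ', pow_succ', Module.End.mul_apply, ih, Module.End.mul_apply]
    exact LinearMap.congr_fun h _

theorem rTensor_commute_lTensor (A₁ : Module.End ℂ V₁) (A₂ : Module.End ℂ V₂) :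
    Commute (A₁.rTensor V₂ : Module.End ℂ (TensorProduct ℂ V₁ V₂)) (A₂.lTensor V₁) := by
  apply TensorProduct.ext'
  intro u v
  simp

theorem rTensor_pow_tmul (u : V₁) (v : V₂) (k : ℕ) :
    ((A₁.rTensor V₂ : Module.End ℂ (TensorProduct ℂ V₁ V₂)) ^ k) (u ⊗ₜ v) =
      ((A₁ ^ k) u) ⊗ₜ v := by
  rw [LinearMap.rTensor_pow, LinearMap.rTensor_tmul]

theorem lTensor_pow_tmul (u : V₁) (v : V₂) (k : ℕ) :
    ((A₂.lTensor V₁ : Module.End ℂ (TensorProduct ℂ V₁ V₂)) ^ k) (u ⊗ₜ v) =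
      u ⊗ₜ ((A₂ ^ k) v) := by
  rw [LinearMap.lTensor_pow, LinearMap.lTensor_tmul]

theorem pow_bilinear_eq_zero (hB : ∀ u v, A₃ (B u v) = B (A₁ u) v + B u (A₂ v)) {u : V₁} {v : V₂}
    {a b : ℕ} (ha : (A₁ ^ (a + 1)) u = 0) (hb : (A₂ ^ (b + 1)) v = 0) :
    (A₃ ^ (a + b + 1)) (B u v) = 0 := by
  rw [← TensorProduct.lift.tmul, pow_lift_tmul hB, pow_add_apply_eq_zero
    (rTensor_commute_lTensor A₁ A₂), map_zero]
  · rw [rTensor_pow_tmul, ha, TensorProduct.zero_tmul]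
  · rw [lTensor_pow_tmul, hb, TensorProduct.tmul_zero]

theorem LocNilpotent.bilinear (hB : ∀ u v, A₃ (B u v) = B (A₁ u) v + B u (A₂ v)) {u : V₁}
    {v : V₂} (hu : LocNilpotent A₁ u) (hv : LocNilpotent A₂ v) : LocNilpotent A₃ (B u v) :=
  let ⟨_, ha⟩ := hu.exists_succ
  let ⟨_, hb⟩ := hv.exists_succ
  ⟨_, pow_bilinear_eq_zero hB ha hb⟩

/-- The exponential of operators satisfying the Leibniz rule for a bilinear map is compatible with
this map. -/
theorem locExp_bilinear (hB : ∀ u v, A₃ (B u v) = B (A₁ u) v + B u (A₂ v)) {u : V₁} {v : V₂}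
    (hu : LocNilpotent A₁ u) (hv : LocNilpotent A₂ v) :
    locExp A₃ (B u v) = B (locExp A₁ u) (locExp A₂ v) := by
  obtain ⟨a, ha⟩ := hu.exists_succ
  obtain ⟨b, hb⟩ := hv.exists_succ
  have h := locExp_add_of_commute (rTensor_commute_lTensor A₁ A₂) (f := u ⊗ₜ v) (a := a) (b := b)
    (by rw [rTensor_pow_tmul, ha, TensorProduct.zero_tmul])
    (by rw [lTensor_pow_tmul, hb, TensorProduct.tmul_zero])
  have h' : locExp A₃ (B u v) = TensorProduct.lift B
      (locExp (A₁.rTensor V₂ + A₂.lTensor V₁) (u ⊗ₜ v)) := by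
    have hn : ((A₁.rTensor V₂ + A₂.lTensor V₁) ^ (a + b + 1)) (u ⊗ₜ[ℂ] v) = 0 :=
      pow_add_apply_eq_zero (rTensor_commute_lTensor A₁ A₂)
        (by rw [rTensor_pow_tmul, ha, TensorProduct.zero_tmul])
        (by rw [lTensor_pow_tmul, hb, TensorProduct.tmul_zero])
    rw [locExp_eq_sum (pow_bilinear_eq_zero hB ha hb), locExp_eq_sum hn, map_sum]
    refine Finset.sum_congr rfl fun n _ => ?_
    rw [← TensorProduct.lift.tmul, pow_lift_tmul hB, map_smul]
  rw [h', h, locExp_eq_sum ha, locExp_eq_sum hb]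
  simp only [map_sum, map_smul, lTensor_pow_tmul, rTensor_pow_tmul, TensorProduct.lift.tmul,
    LinearMap.sum_apply, LinearMap.smul_apply, Finset.smul_sum]
  rw [Finset.sum_comm]
  exact Finset.sum_congr rfl fun l _ => Finset.sum_congr rfl fun k _ => smul_comm ..

end Bilinear

end LocExp

/-! ## Commutators -/

/-- The operator `b ↦ ½ (b a - a b)`. -/
def halfComm {A : Type*} [Ring A] [Algebra ℂ A] (a : A) : Module.End ℂ A :=
  (1 / 2 : ℂ) • (LinearMap.mulRight ℂ a - LinearMap.mulLeft ℂ a)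

theorem halfComm_apply {A : Type*} [Ring A] [Algebra ℂ A] (a b : A) :
    halfComm a b = (1 / 2 : ℂ) • (b * a - a * b) := rfl

/-- A commutator is a derivation; the product is written as a bilinear map to fit `locExp_bilinear`.
-/
theorem halfComm_mul {A : Type*} [Ring A] [Algebra ℂ A] (a b c : A) :
    halfComm a (LinearMap.mul ℂ A b c) =
      LinearMap.mul ℂ A (halfComm a b) c + LinearMap.mul ℂ A b (halfComm a c) := by
  simp only [halfComm_apply, LinearMap.mul_apply', smul_mul_assoc, mul_smul_comm, ← smul_add]
  congr 1
  simp only [mul_sub, sub_mul, mul_assoc]; abel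

/-- With the factor `½` absorbed into the derivation, `harmonicOp` becomes a truncated exponential
series. -/
theorem halfComm_pow {V : Type*} [AddCommGroup V] [Module ℂ V] (L D : Module.End ℂ V) (n : ℕ) :
    (halfComm L ^ n) D = (1 / 2 ^ n : ℂ) • iterComm L D n := by
  induction n with
  | zero => simp [iterComm]
  | succ n ih =>
    rw [pow_succ', Module.End.mul_apply, ih, map_smul, halfComm_apply, smul_smul, iterComm,
      iterComm, Function.iterate_succ_apply']
    congr 1
    rw [pow_succ]; ring

theorem harmonicOp_eq_sum {N : ℕ} (m : ℂ) (d : ℕ) (D : Module.End ℂ (RatFun N)) :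
    harmonicOp m d D = ∑ n ∈ Finset.range (d + 1),
      (1 / (n.factorial : ℂ)) • (halfComm (opL N m) ^ n) D := by
  refine Finset.sum_congr rfl fun n _ => ?_
  rw [halfComm_pow, smul_smul]
  congr 1
  rw [one_div_mul_one_div, mul_comm]

theorem harmonicOp_eq_locExp {N : ℕ} {m : ℂ} {d : ℕ} {D : Module.End ℂ (RatFun N)}
    (h : (halfComm (opL N m) ^ (d + 1)) D = 0) :
    harmonicOp m d D = locExp (halfComm (opL N m)) D := by
  rw [harmonicOp_eq_sum, locExp_eq_sum h]

/-- `LinearMap.applyₗ.flip` is the evaluation pairing `(D, f) ↦ D f`. This is its Leibniz rule: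
`-½L` acts on vectors and `½[·, L]` on operators. -/
theorem half_neg_smul_apply {V : Type*} [AddCommGroup V] [Module ℂ V] (L D : Module.End ℂ V)
    (f : V) :
    (-(1 / 2 : ℂ) • L) (LinearMap.applyₗ.flip D f) =
      LinearMap.applyₗ.flip (halfComm L D) f +
        LinearMap.applyₗ.flip D ((-(1 / 2 : ℂ) • L) f) := by
  simp only [LinearMap.flip_apply, LinearMap.applyₗ_apply_apply, halfComm_apply,
    LinearMap.smul_apply, LinearMap.sub_apply, Module.End.mul_apply, map_smul]
  module

/-- The local nilpotency of `L` is preserved by the operators at which the commutator with `L` is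
locally nilpotent. -/
theorem LocNilpotent.apply_of_halfComm {V : Type*} [AddCommGroup V] [Module ℂ V]
    {L D : Module.End ℂ V} {f : V} (hD : LocNilpotent (halfComm L) D) (hf : LocNilpotent L f) :
    LocNilpotent L (D f) := by
  have h := LocNilpotent.bilinear (half_neg_smul_apply L) hD (hf.smul (-(1 / 2 : ℂ)))
  exact (locNilpotent_smul_iff (by norm_num)).mp h

/-- The conjugation by the exponential is the exponential of the commutator. -/
theorem locExp_halfComm_apply {V : Type*} [AddCommGroup V] [Module ℂ V]
    {L D : Module.End ℂ V} {f : V} (hD : LocNilpotent (halfComm L) D) (hf : LocNilpotent L f) :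
    locExp (halfComm L) D f =
      locExp (-(1 / 2 : ℂ) • L) (D (locExp ((1 / 2 : ℂ) • L) f)) := by
  have hf' : LocNilpotent L (locExp ((1 / 2 : ℂ) • L) f) := by
    obtain ⟨n, hn⟩ := hf
    refine ⟨n, ?_⟩
    have hn' : (((1 / 2 : ℂ) • L) ^ n) f = 0 := by
      rw [smul_pow, LinearMap.smul_apply, hn, smul_zero]
    rw [locExp_eq_sum hn', map_sum]
    refine Finset.sum_eq_zero fun k _ => ?_
    rw [map_smul, smul_pow, LinearMap.smul_apply, map_smul, ← Module.End.mul_apply, ← pow_add,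
      add_comm, pow_add, Module.End.mul_apply, hn, map_zero, smul_zero, smul_zero]
  -- The Leibniz rule is applied to the vector `e^{L/2} f`, on which the exponential `e^{-L/2}`
  -- gives back `f`.
  have h := locExp_bilinear (half_neg_smul_apply L) hD (hf'.smul (-(1 / 2 : ℂ)))
  simp only [LinearMap.flip_apply, LinearMap.applyₗ_apply_apply] at h
  rw [h, neg_smul, locExp_neg_locExp (hf.smul _)]

/-! ## The automorphism `γ` as an exponential -/

/-- The source of the term `-y_i` in `γ(x_i) = x_i - y_i`. -/
theorem halfComm_HLap_Hx {N : ℕ} (m : ℂ) (i : Fin N) :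
    halfComm (HLap N m) (Hx m i) = -Hy m i := by
  rw [halfComm_apply, ← neg_sub, HLap_Hx, ← neg_one_smul ℂ (Hy m i), ← neg_one_smul ℂ (_ • _),
    smul_smul, smul_smul]
  norm_num

theorem halfComm_HLap_Hy {N : ℕ} (m : ℂ) (i : Fin N) : halfComm (HLap N m) (Hy m i) = 0 := by
  rw [halfComm_apply, HLap_Hy, sub_self, smul_zero]

theorem halfComm_HLap_Hw {N : ℕ} (m : ℂ) (w : Equiv.Perm (Fin N)) :
    halfComm (HLap N m) (Hw m w) = 0 := by
  rw [halfComm_apply, mem_invariantSubalgebra.mp (HLap_mem_invariantSubalgebra N m), sub_self,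
    smul_zero]

theorem Cherednik_induction {N : ℕ} {m : ℂ} {C : Cherednik N m → Prop}
    (hx : ∀ i, C (Hx m i)) (hy : ∀ i, C (Hy m i)) (hw : ∀ w, C (Hw m w))
    (hscalar : ∀ r : ℂ, C (algebraMap ℂ _ r)) (hmul : ∀ a b, C a → C b → C (a * b))
    (hadd : ∀ a b, C a → C b → C (a + b)) (h : Cherednik N m) : C h := by
  obtain ⟨a, rfl⟩ : ∃ a, Hmk N m a = h := RingQuot.mkAlgHom_surjective ℂ _ h
  induction a using FreeAlgebra.induction with
  | grade0 r => rw [AlgHom.commutes]; exact hscalar r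
  | grade1 g =>
    cases g with
    | x i => exact hx i
    | y i => exact hy i
    | w σ => exact hw σ
  | mul a b ha hb => rw [map_mul]; exact hmul _ _ ha hb
  | add a b ha hb => rw [map_add]; exact hadd _ _ ha hb

/-- The exponential of a derivation is multiplicative, so it is enough to compare on generators.
Local nilpotency belongs to the same induction, because the multiplicativity of `locExp` depends on
it. -/
theorem gammaAut_eq_locExp {N : ℕ} {m : ℂ} (h : Cherednik N m) :
    LocNilpotent (halfComm (HLap N m)) h ∧ gammaAut N m h = locExp (halfComm (HLap N m)) h := by
  induction h using Cherednik_induction with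
  | hx i =>
    have h2 : (halfComm (HLap N m) ^ 2) (Hx m i) = 0 := by
      rw [sq, Module.End.mul_apply, halfComm_HLap_Hx, map_neg, halfComm_HLap_Hy, neg_zero]
    refine ⟨⟨2, h2⟩, ?_⟩
    rw [locExp_eq_sum h2]
    refine (shearHom_Hx m (-1) 1 i).trans ?_
    simp [Finset.sum_range_succ, halfComm_HLap_Hx]
  | hy i =>
    refine ⟨⟨1, by rw [pow_one, halfComm_HLap_Hy]⟩, ?_⟩
    rw [locExp_of_apply_eq_zero (halfComm_HLap_Hy m i)]
    exact shearHom_Hy ..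
  | hw w =>
    refine ⟨⟨1, by rw [pow_one, halfComm_HLap_Hw]⟩, ?_⟩
    rw [locExp_of_apply_eq_zero (halfComm_HLap_Hw m w)]
    exact shearHom_Hw ..
  | hscalar r =>
    have h0 : halfComm (HLap N m) (algebraMap ℂ _ r) = 0 := by
      rw [halfComm_apply, Algebra.commutes, sub_self, smul_zero]
    exact ⟨⟨1, by rw [pow_one, h0]⟩, by rw [locExp_of_apply_eq_zero h0, AlgEquiv.commutes]⟩
  | hmul a b ha hb =>
    refine ⟨ha.1.bilinear (halfComm_mul _) hb.1, ?_⟩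
    have h := locExp_bilinear (halfComm_mul (HLap N m)) ha.1 hb.1
    rw [LinearMap.mul_apply', LinearMap.mul_apply', ← ha.2, ← hb.2] at h
    rw [h, map_mul]
  | hadd a b ha hb =>
    exact ⟨ha.1.add hb.1, by rw [map_add, locExp_add ha.1 hb.1, ha.2, hb.2]⟩

/-- The reason why the sum defining `𝓛_p^ℋ` may stop at `deg p`. The second power of the derivation
kills `x_i` and the first kills `y_i`, so the second kills `π_i`; by the Leibniz rule each further
letter costs one more power. -/
theorem halfComm_pow_evalPi {N : ℕ} (m : ℂ) {d : ℕ} {P : FreeAlgebra ℂ (Fin N)}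
    (hP : P ∈ Submodule.span ℂ {u : FreeAlgebra ℂ (Fin N) |
      ∃ s : List (Fin N), s.length ≤ d ∧ u = (s.map (FreeAlgebra.ι ℂ)).prod}) :
    (halfComm (HLap N m) ^ (d + 1)) (evalPi m P) = 0 := by
  have word : ∀ s : List (Fin N),
      (halfComm (HLap N m) ^ (s.length + 1)) ((s.map (Hpi m)).prod) = 0 := by
    intro s
    induction s with
    | nil => simp [halfComm_apply]
    | cons i s ih =>
      rw [List.map_cons, List.prod_cons, List.length_cons]
      have hx : (halfComm (HLap N m) ^ (1 + 1)) (Hx m i) = 0 := by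
        rw [pow_succ, pow_one, Module.End.mul_apply, halfComm_HLap_Hx, map_neg, halfComm_HLap_Hy,
          neg_zero]
      have hy : (halfComm (HLap N m) ^ (0 + 1)) (Hy m i) = 0 := by
        rw [zero_add, pow_one, halfComm_HLap_Hy]
      have hpi : (halfComm (HLap N m) ^ (1 + 0 + 1)) (Hpi m i) = 0 :=
        pow_bilinear_eq_zero (halfComm_mul (HLap N m)) hx hy
      rw [add_comm s.length]
      exact pow_bilinear_eq_zero (halfComm_mul (HLap N m)) hpi ih
  induction hP using Submodule.span_induction with
  | mem u hu =>
    obtain ⟨s, hs, rfl⟩ := hu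
    rw [evalPi, map_list_prod, List.map_map]
    have : (FreeAlgebra.lift ℂ (Hpi m)) ∘ FreeAlgebra.ι ℂ = Hpi (N := N) m :=
      FreeAlgebra.ι_comp_lift (Hpi m)
    rw [this]
    exact pow_apply_eq_zero_of_le (word s) (by omega)
  | zero => simp [evalPi]
  | add a b _ _ ha hb =>
    simp only [evalPi, map_add] at ha hb ⊢
    rw [ha, hb, add_zero]
  | smul c a _ ha =>
    simp only [evalPi, map_smul] at ha ⊢
    rw [ha, smul_zero]

/-! ## Derivations of the field of rational functions -/

theorem ratFun_derivation_eq_zero {N : ℕ} (δ : Derivation ℂ (RatFun N) (RatFun N))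
    (h : ∀ i, δ (ratX i) = 0) : δ = 0 := by
  have hp : ∀ p : PolyC N, δ (algebraMap (PolyC N) (RatFun N) p) = 0 := by
    intro p
    induction p using MvPolynomial.induction_on with
    | C a =>
      have : algebraMap (PolyC N) (RatFun N) (MvPolynomial.C a) = algebraMap ℂ (RatFun N) a :=
        (IsScalarTower.algebraMap_apply ℂ (PolyC N) (RatFun N) a).symm
      rw [this, Derivation.map_algebraMap]
    | add p q hp hq => rw [map_add, map_add, hp, hq, add_zero]
    | mul_X p i hp =>
      have hi := h i
      rw [ratX] at hi
      rw [map_mul, Derivation.leibniz, hp, hi, smul_zero, smul_zero, add_zero]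
  ext f
  obtain ⟨a, b, hb, rfl⟩ := IsFractionRing.div_surjective (A := PolyC N) f
  have hb0 : algebraMap (PolyC N) (RatFun N) b ≠ 0 :=
    IsFractionRing.to_map_ne_zero_of_mem_nonZeroDivisors hb
  -- Leibniz for `b · (a / b) = a`, where `δ` vanishes on `a` and `b`.
  have e := δ.leibniz (algebraMap (PolyC N) (RatFun N) b)
    (algebraMap (PolyC N) (RatFun N) a / algebraMap (PolyC N) (RatFun N) b)
  rw [mul_div_cancel₀ _ hb0, hp, hp, smul_zero, add_zero, smul_eq_mul] at e
  exact (mul_eq_zero.mp e.symm).resolve_left hb0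

theorem ratX_injective {N : ℕ} : Function.Injective (ratX : Fin N → RatFun N) :=
  (IsFractionRing.injective (PolyC N) (RatFun N)).comp MvPolynomial.X_injective

theorem ratX_sub_ne_zero {N : ℕ} {i j : Fin N} (h : i ≠ j) : ratX i - ratX j ≠ 0 :=
  sub_ne_zero.mpr fun e => h (ratX_injective e)

/-- A derivation of `ℂ(x)` over the symmetric polynomials is zero. -/
theorem ratFun_derivation_eq_zero_of_symPoly {N : ℕ} (δ : Derivation ℂ (RatFun N) (RatFun N))
    (h : ∀ q ∈ symPoly N, δ (algebraMap (PolyC N) (RatFun N) q) = 0) : δ = 0 := by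
  apply ratFun_derivation_eq_zero
  intro i
  -- `∏ (T - x_j)` has symmetric coefficients and the simple root `x_i`. Applying `δ` to `Q(x_i) =
  -- 0` therefore gives `Q'(x_i) δ(x_i) = 0` with `Q'(x_i) ≠ 0`.
  let P : Polynomial (PolyC N) :=
    ∏ j : Fin N, (Polynomial.X - Polynomial.C (MvPolynomial.X j : PolyC N))
  let Q : Polynomial (RatFun N) := P.map (algebraMap (PolyC N) (RatFun N))
  have hQ : Q = ∏ j : Fin N, (Polynomial.X - Polynomial.C (ratX j)) := by
    simp only [Q, P, Polynomial.map_prod, Polynomial.map_sub, Polynomial.map_X,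
      Polynomial.map_C, ratX]
  have hcoeff : ∀ n, P.coeff n ∈ symPoly N := by
    intro n
    rw [MvPolynomial.mem_symmetricSubalgebra]
    intro w
    have hP : P.map ((MvPolynomial.rename w : PolyC N →ₐ[ℂ] PolyC N) : PolyC N →+* PolyC N) =
        P := by
      simp only [P, Polynomial.map_prod, Polynomial.map_sub, Polynomial.map_X,
        Polynomial.map_C, RingHom.coe_coe, MvPolynomial.rename_X]
      exact Equiv.prod_comp w fun j => Polynomial.X - Polynomial.C (MvPolynomial.X j : PolyC N)
    have := congrArg (fun R => Polynomial.coeff R n) hP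
    simp only [Polynomial.coeff_map] at this
    exact this
  have h0 : Q.eval (ratX i) = 0 := by
    rw [hQ, Polynomial.eval_prod]
    exact Finset.prod_eq_zero (Finset.mem_univ i) (by simp)
  have hd : δ (Q.eval (ratX i)) = Q.derivative.eval (ratX i) * δ (ratX i) := by
    rw [Polynomial.eval_eq_sum, Polynomial.sum, map_sum, Polynomial.derivative_eval,
      Polynomial.sum, Finset.sum_mul]
    refine Finset.sum_congr rfl fun n _ => ?_
    have hc : δ (Q.coeff n) = 0 := by
      rw [Polynomial.coeff_map]; exact h _ (hcoeff n)
    rw [Derivation.leibniz, hc, smul_zero, add_zero, Derivation.leibniz_pow]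
    simp only [smul_eq_mul, nsmul_eq_mul]
    ring
  have hne : Q.derivative.eval (ratX i) ≠ 0 := by
    rw [hQ, Polynomial.derivative_prod_finset, Polynomial.eval_finsetSum,
      Finset.sum_eq_single_of_mem i (Finset.mem_univ i)]
    · simp only [Polynomial.derivative_sub, Polynomial.derivative_X, Polynomial.derivative_C,
        sub_zero, mul_one, Polynomial.eval_prod, Polynomial.eval_sub, Polynomial.eval_X,
        Polynomial.eval_C]
      rw [Finset.prod_ne_zero_iff]
      intro j hj
      exact ratX_sub_ne_zero (Finset.ne_of_mem_erase hj).symm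
    · intro j _ hji
      rw [Polynomial.eval_mul, Polynomial.eval_prod,
        Finset.prod_eq_zero (Finset.mem_erase.mpr ⟨hji.symm, Finset.mem_univ i⟩) (by simp),
        zero_mul]
  rw [h0, map_zero] at hd
  exact (mul_eq_zero.mp hd.symm).resolve_left hne

/-! ## Differential operators -/

/-- Multiplication by a rational function. -/
abbrev mulOp {N : ℕ} (f : RatFun N) : Module.End ℂ (RatFun N) := LinearMap.mulLeft ℂ f

theorem mulOp_mul {N : ℕ} (f g : RatFun N) : mulOp (f * g) = mulOp f * mulOp g :=
  LinearMap.ext fun h => mul_assoc f g h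

theorem mulOp_comm {N : ℕ} (f g : RatFun N) : mulOp f * mulOp g = mulOp g * mulOp f := by
  rw [← mulOp_mul, mul_comm, mulOp_mul]

theorem mulOp_mem_diffOps {N : ℕ} (f : RatFun N) : mulOp f ∈ diffOps N :=
  Algebra.subset_adjoin (Or.inl ⟨f, rfl⟩)

theorem dOp_mem_diffOps {N : ℕ} (i : Fin N) : dOp i ∈ diffOps N :=
  Algebra.subset_adjoin (Or.inr ⟨i, rfl⟩)

/-- Operators of order less than `n`: `n` iterated commutators with functions vanish. -/
def OrderLT {N : ℕ} : ℕ → Module.End ℂ (RatFun N) → Prop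
  | 0, D => D = 0
  | n + 1, D => ∀ f : RatFun N, OrderLT n (D * mulOp f - mulOp f * D)

theorem OrderLT.zero {N : ℕ} (n : ℕ) : OrderLT n (0 : Module.End ℂ (RatFun N)) := by
  induction n with
  | zero => rfl
  | succ n ih => intro f; simpa using ih

theorem OrderLT.add {N : ℕ} {n : ℕ} {D E : Module.End ℂ (RatFun N)} (hD : OrderLT n D)
    (hE : OrderLT n E) : OrderLT n (D + E) := by
  induction n generalizing D E with
  | zero => rw [OrderLT] at hD hE ⊢; rw [hD, hE, add_zero]
  | succ n ih =>
    intro f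
    have := ih (hD f) (hE f)
    convert this using 1
    rw [add_mul, mul_add]; abel

theorem OrderLT.succ {N : ℕ} {n : ℕ} {D : Module.End ℂ (RatFun N)} (hD : OrderLT n D) :
    OrderLT (n + 1) D := by
  induction n generalizing D with
  | zero =>
    intro f
    rw [OrderLT] at hD
    rw [hD]; simp [OrderLT]
  | succ n ih => exact fun f => ih (hD f)

theorem OrderLT.mono {N : ℕ} {n k : ℕ} {D : Module.End ℂ (RatFun N)} (hD : OrderLT n D)
    (h : n ≤ k) : OrderLT k D := by
  induction h with
  | refl => exact hD
  | step _ ih => exact ih.succ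

/-- The bound `n + k` is not sharp; only finiteness of the order matters later. -/
theorem OrderLT.mul {N : ℕ} {n k : ℕ} {D E : Module.End ℂ (RatFun N)} (hD : OrderLT n D)
    (hE : OrderLT k E) : OrderLT (n + k) (D * E) := by
  induction n generalizing D E k with
  | zero =>
    rw [OrderLT] at hD
    rw [hD, zero_mul]; exact OrderLT.zero _
  | succ n ihn =>
    induction k generalizing D E with
    | zero =>
      rw [OrderLT] at hE
      rw [hE, mul_zero]; exact OrderLT.zero _
    | succ k ihk =>
      intro f
      have h1 : OrderLT (n + (k + 1)) ((D * mulOp f - mulOp f * D) * E) := ihn (hD f) hE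
      have h2 : OrderLT (n + 1 + k) (D * (E * mulOp f - mulOp f * E)) := ihk hD (hE f)
      have h3 := h1.add (h2.mono (by omega))
      have e : D * E * mulOp f - mulOp f * (D * E) =
          (D * mulOp f - mulOp f * D) * E + D * (E * mulOp f - mulOp f * E) := by
        simp only [mul_sub, sub_mul, mul_assoc]; abel
      rw [e]
      exact h3.mono (show n + (k + 1) ≤ n + 1 + k by omega)

theorem orderLT_mulOp {N : ℕ} (f : RatFun N) : OrderLT 1 (mulOp f) := by
  intro g
  rw [mulOp_comm, sub_self]; rfl

theorem dOp_mul_mulOp {N : ℕ} (i : Fin N) (f : RatFun N) :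
    dOp i * mulOp f - mulOp f * dOp i = mulOp (ratDeriv i f) := by
  apply LinearMap.ext
  intro g
  change ratDeriv i (f * g) - f * ratDeriv i g = ratDeriv i f * g
  rw [Derivation.leibniz, smul_eq_mul, smul_eq_mul]; ring

/-- This makes induction on the order available for operators given by generators. -/
theorem exists_orderLT {N : ℕ} {D : Module.End ℂ (RatFun N)} (hD : D ∈ diffOps N) :
    ∃ n, OrderLT n D := by
  induction hD using Algebra.adjoin_induction with
  | mem D h =>
    rcases h with ⟨f, rfl⟩ | ⟨i, rfl⟩
    · exact ⟨1, orderLT_mulOp f⟩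
    · exact ⟨2, fun f => by rw [dOp_mul_mulOp]; exact orderLT_mulOp _⟩
  | algebraMap r =>
    refine ⟨1, ?_⟩
    convert orderLT_mulOp (algebraMap ℂ (RatFun N) r) using 1
    apply LinearMap.ext
    intro f
    exact Algebra.smul_def r f
  | add D E _ _ hD hE =>
    obtain ⟨n, hn⟩ := hD
    obtain ⟨k, hk⟩ := hE
    exact ⟨max n k, (hn.mono (le_max_left n k)).add (hk.mono (le_max_right n k))⟩
  | mul D E _ _ hD hE =>
    obtain ⟨n, hn⟩ := hD
    obtain ⟨k, hk⟩ := hE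
    exact ⟨n + k, hn.mul hk⟩

theorem eq_mulOp_of_commute {N : ℕ} {D : Module.End ℂ (RatFun N)}
    (h : ∀ f, D * mulOp f = mulOp f * D) : D = mulOp (D 1) := by
  apply LinearMap.ext
  intro f
  have := LinearMap.congr_fun (h f) 1
  simp only [Module.End.mul_apply, LinearMap.mulLeft_apply, mul_one] at this
  rw [this, LinearMap.mulLeft_apply, mul_comm]

/-- A finite order operator commuting with the symmetric polynomials commutes with all functions. -/
theorem OrderLT.commute_of_symPoly {N : ℕ} {n : ℕ} {D : Module.End ℂ (RatFun N)}
    (hD : OrderLT n D) (h : ∀ q ∈ symPoly N, D * mulOp (algebraMap (PolyC N) (RatFun N) q) =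
      mulOp (algebraMap (PolyC N) (RatFun N) q) * D) (f : RatFun N) :
    D * mulOp f = mulOp f * D := by
  induction n generalizing D f with
  | zero => rw [OrderLT] at hD; rw [hD, zero_mul, mul_zero]
  | succ n ih =>
    -- `[D, f]` has smaller order and still commutes with the symmetric polynomials, so by induction
    -- it commutes with all functions and is itself a multiplication.
    have hcomm : ∀ f g : RatFun N, (D * mulOp f - mulOp f * D) * mulOp g =
        mulOp g * (D * mulOp f - mulOp f * D) := by
      intro f g
      refine ih (hD f) (fun q hq => ?_) g
      rw [sub_mul, mul_sub, mul_assoc, mulOp_comm, ← mul_assoc, h q hq, mul_assoc, mul_assoc,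
        h q hq, ← mul_assoc (mulOp f), mulOp_comm, mul_assoc]
    have hval : ∀ f, D * mulOp f - mulOp f * D = mulOp ((D * mulOp f - mulOp f * D) 1) :=
      fun f => eq_mulOp_of_commute (hcomm f)
    -- The function by which `[D, f]` multiplies depends on `f` as a derivation, and this derivation
    -- vanishes on `Λ_N`.
    let δ : Derivation ℂ (RatFun N) (RatFun N) := Derivation.mk'
      { toFun := fun f => (D * mulOp f - mulOp f * D) 1
        map_add' := fun f g => by
          simp only [LinearMap.sub_apply, Module.End.mul_apply, LinearMap.mulLeft_apply, mul_one,
            map_add, add_mul]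
          ring
        map_smul' := fun c f => by
          simp only [LinearMap.sub_apply, Module.End.mul_apply, LinearMap.mulLeft_apply, mul_one,
            map_smul, smul_mul_assoc, RingHom.id_apply, smul_sub] }
      (fun f g => by
        simp only [LinearMap.coe_mk, AddHom.coe_mk, smul_eq_mul]
        have e : D * mulOp (f * g) - mulOp (f * g) * D =
            (D * mulOp f - mulOp f * D) * mulOp g + mulOp f * (D * mulOp g - mulOp g * D) := by
          rw [mulOp_mul]; simp only [mul_sub, sub_mul, mul_assoc]; abel
        rw [e, hcomm f g, LinearMap.add_apply, Module.End.mul_apply, Module.End.mul_apply,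
          LinearMap.mulLeft_apply, LinearMap.mulLeft_apply, add_comm])
    have hδ : δ = 0 := by
      apply ratFun_derivation_eq_zero_of_symPoly
      intro q hq
      change (D * mulOp (algebraMap (PolyC N) (RatFun N) q) -
        mulOp (algebraMap (PolyC N) (RatFun N) q) * D) (1 : RatFun N) = 0
      rw [h q hq, sub_self, LinearMap.zero_apply]
    have : (D * mulOp f - mulOp f * D) 1 = 0 := DFunLike.congr_fun hδ f
    rw [← sub_eq_zero, hval, this]
    exact LinearMap.ext fun g => zero_mul g

/-- For symmetric `q` the operator `[D, q]` also kills `Λ_N` and has smaller order, hence is zero.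
Then `D` commutes with all functions, so it is multiplication by `D 1 = 0`. -/
theorem OrderLT.eq_zero_of_symPoly {N : ℕ} {n : ℕ} {D : Module.End ℂ (RatFun N)}
    (hD : OrderLT n D) (h : ∀ q ∈ symPoly N, D (algebraMap (PolyC N) (RatFun N) q) = 0) :
    D = 0 := by
  induction n generalizing D with
  | zero => exact hD
  | succ n ih =>
    have hc : ∀ q ∈ symPoly N, D * mulOp (algebraMap (PolyC N) (RatFun N) q) =
        mulOp (algebraMap (PolyC N) (RatFun N) q) * D := by
      intro q hq
      rw [← sub_eq_zero]
      refine ih (hD _) fun r hr => ?_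
      rw [LinearMap.sub_apply, Module.End.mul_apply, Module.End.mul_apply,
        LinearMap.mulLeft_apply, LinearMap.mulLeft_apply, ← map_mul, h _ (mul_mem hq hr), h r hr,
        mul_zero, sub_zero]
    have h1 : D 1 = 0 := by
      simpa using h 1 (one_mem _)
    rw [eq_mulOp_of_commute (hD.commute_of_symPoly hc), h1]
    exact LinearMap.ext fun g => zero_mul g

/-- A differential operator with rational coefficients is determined by its action on symmetric
polynomials. -/
theorem diffOps_ext {N : ℕ} {D E : Module.End ℂ (RatFun N)} (hD : D ∈ diffOps N)
    (hE : E ∈ diffOps N) (h : ∀ q ∈ symPoly N, D (algebraMap (PolyC N) (RatFun N) q) =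
      E (algebraMap (PolyC N) (RatFun N) q)) : D = E := by
  obtain ⟨n, hn⟩ := exists_orderLT (sub_mem hD hE)
  rw [← sub_eq_zero]
  exact hn.eq_zero_of_symPoly fun q hq => by rw [LinearMap.sub_apply, h q hq, sub_self]

/-! ### Permutations -/

theorem ratPerm_algebraMap {N : ℕ} (w : Equiv.Perm (Fin N)) (p : PolyC N) :
    ratPerm w (algebraMap (PolyC N) (RatFun N) p) =
      algebraMap (PolyC N) (RatFun N) (MvPolynomial.rename w p) :=
  IsFractionRing.algEquivOfAlgEquiv_algebraMap _ p

theorem ratPerm_symPoly {N : ℕ} (w : Equiv.Perm (Fin N)) {q : PolyC N} (hq : q ∈ symPoly N) :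
    ratPerm w (algebraMap (PolyC N) (RatFun N) q) = algebraMap (PolyC N) (RatFun N) q := by
  rw [ratPerm_algebraMap, (MvPolynomial.mem_symmetricSubalgebra q).mp hq w]

theorem ratPerm_symm_symPoly {N : ℕ} (w : Equiv.Perm (Fin N)) {q : PolyC N} (hq : q ∈ symPoly N) :
    (ratPerm w).symm (algebraMap (PolyC N) (RatFun N) q) = algebraMap (PolyC N) (RatFun N) q := by
  rw [AlgEquiv.symm_apply_eq, ratPerm_symPoly w hq]

/-- Conjugation of operators by a permutation. -/
def conjOp {N : ℕ} (w : Equiv.Perm (Fin N)) :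
    Module.End ℂ (RatFun N) ≃ₐ[ℂ] Module.End ℂ (RatFun N) :=
  (ratPerm w).toLinearEquiv.conjAlgEquiv ℂ

theorem conjOp_apply {N : ℕ} (w : Equiv.Perm (Fin N)) (D : Module.End ℂ (RatFun N))
    (f : RatFun N) : conjOp w D f = ratPerm w (D ((ratPerm w).symm f)) := rfl

theorem ratDeriv_ratX {N : ℕ} (i j : Fin N) :
    ratDeriv i (ratX j) = if i = j then 1 else 0 := by
  rw [ratX, ratDeriv_algebraMap, MvPolynomial.pderiv_X]
  by_cases h : i = j
  · subst h; simp
  · rw [Pi.single_eq_of_ne (Ne.symm h), map_zero, if_neg h]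

theorem ratPerm_ratX {N : ℕ} (w : Equiv.Perm (Fin N)) (i : Fin N) :
    ratPerm w (ratX i) = ratX (w i) := by
  rw [ratX, ratPerm_algebraMap, MvPolynomial.rename_X, ratX]

/-- The conjugate of a derivation by a field automorphism is a derivation, so comparing on the
coordinates suffices. -/
theorem conjOp_dOp {N : ℕ} (w : Equiv.Perm (Fin N)) (i : Fin N) :
    conjOp w (dOp i) = dOp (w i) := by
  let δ : Derivation ℂ (RatFun N) (RatFun N) := Derivation.mk' (conjOp w (dOp i)) (fun f g => by
    have h1 : (ratPerm w).symm (f * g) = (ratPerm w).symm f * (ratPerm w).symm g := map_mul _ f g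
    have h2 : dOp i ((ratPerm w).symm f * (ratPerm w).symm g) =
        (ratPerm w).symm f * dOp i ((ratPerm w).symm g) +
          (ratPerm w).symm g * dOp i ((ratPerm w).symm f) := (ratDeriv i).leibniz _ _
    rw [conjOp_apply, conjOp_apply, conjOp_apply, h1, h2, map_add, map_mul, map_mul,
      AlgEquiv.apply_symm_apply, AlgEquiv.apply_symm_apply, smul_eq_mul, smul_eq_mul])
  have h : δ - ratDeriv (w i) = 0 := by
    apply ratFun_derivation_eq_zero
    intro j
    change ratPerm w (ratDeriv i ((ratPerm w).symm (ratX j))) - ratDeriv (w i) (ratX j) = 0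
    obtain ⟨k, rfl⟩ := w.surjective j
    rw [← ratPerm_ratX, AlgEquiv.symm_apply_apply, ratPerm_ratX, ratDeriv_ratX, ratDeriv_ratX]
    by_cases hik : i = k
    · subst hik; simp
    · simp [hik]
  exact congrArg (fun d : Derivation ℂ (RatFun N) (RatFun N) => d.toLinearMap) (sub_eq_zero.mp h)

theorem conjOp_mem_diffOps {N : ℕ} (w : Equiv.Perm (Fin N)) {D : Module.End ℂ (RatFun N)}
    (hD : D ∈ diffOps N) : conjOp w D ∈ diffOps N := by
  have : diffOps N ≤ (diffOps N).comap (conjOp w : _ →ₐ[ℂ] Module.End ℂ (RatFun N)) := by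
    refine Algebra.adjoin_le ?_
    rintro _ (⟨f, rfl⟩ | ⟨i, rfl⟩)
    · change conjOp w (mulOp f) ∈ diffOps N
      have : conjOp w (mulOp f) = mulOp (ratPerm w f) := by
        apply LinearMap.ext
        intro g
        rw [conjOp_apply, LinearMap.mulLeft_apply, map_mul, AlgEquiv.apply_symm_apply,
          LinearMap.mulLeft_apply]
      rw [this]
      exact mulOp_mem_diffOps _
    · change conjOp w (dOp i) ∈ diffOps N
      rw [conjOp_dOp]
      exact dOp_mem_diffOps _
  exact this hD

/-! ## The restriction to symmetric polynomials -/

theorem polyRep_Hx {N : ℕ} (m : ℂ) (i : Fin N) : polyRep N m (Hx m i) = mulX i := Hlift_gen ..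

theorem polyRep_Hy {N : ℕ} (m : ℂ) (i : Fin N) : polyRep N m (Hy m i) = dunkl m i := Hlift_gen ..

theorem polyRep_Hw {N : ℕ} (m : ℂ) (w : Equiv.Perm (Fin N)) :
    polyRep N m (Hw m w) = permOp w := Hlift_gen ..

theorem permOp_symPoly {N : ℕ} (w : Equiv.Perm (Fin N)) {q : PolyC N} (hq : q ∈ symPoly N) :
    permOp w q = q := (MvPolynomial.mem_symmetricSubalgebra q).mp hq w

theorem mem_symPoly_of_permOp {N : ℕ} {q : PolyC N} (h : ∀ w, permOp w q = q) : q ∈ symPoly N :=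
  (MvPolynomial.mem_symmetricSubalgebra q).mpr h

theorem polyRep_mem_symPoly {N : ℕ} {m : ℂ} {h : Cherednik N m}
    (hh : h ∈ invariantSubalgebra N m) {q : PolyC N} (hq : q ∈ symPoly N) :
    polyRep N m h q ∈ symPoly N := by
  refine mem_symPoly_of_permOp fun w => ?_
  rw [← polyRep_Hw m w, ← Module.End.mul_apply, ← map_mul, mem_invariantSubalgebra.mp hh w, map_mul,
    Module.End.mul_apply, polyRep_Hw, permOp_symPoly w hq]

theorem algebraMap_divDiff {N : ℕ} {i j : Fin N} (h : i ≠ j) (p : PolyC N) :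
    algebraMap (PolyC N) (RatFun N) (divDiff i j p) = 1 / (ratX i - ratX j) *
      (algebraMap (PolyC N) (RatFun N) p -
        ratPerm (Equiv.swap i j) (algebraMap (PolyC N) (RatFun N) p)) := by
  rw [ratPerm_algebraMap, ← map_sub, ← divDiff_spec h, map_mul, map_sub, one_div]
  exact (inv_mul_cancel_left₀ (ratX_sub_ne_zero h) _).symm

theorem algebraMap_smul_polyC {N : ℕ} (c : ℂ) (p : PolyC N) :
    algebraMap (PolyC N) (RatFun N) (c • p) = c • algebraMap (PolyC N) (RatFun N) p :=
  map_smul (IsScalarTower.toAlgHom ℂ (PolyC N) (RatFun N)) c p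

theorem algebraMap_dunkl {N : ℕ} (m : ℂ) (i : Fin N) (p : PolyC N) :
    algebraMap (PolyC N) (RatFun N) (dunkl m i p) =
      dOp i (algebraMap (PolyC N) (RatFun N) p) - m • ∑ j ∈ Finset.univ.erase i,
        1 / (ratX i - ratX j) * (algebraMap (PolyC N) (RatFun N) p -
          ratPerm (Equiv.swap i j) (algebraMap (PolyC N) (RatFun N) p)) := by
  have h1 : dOp i (algebraMap (PolyC N) (RatFun N) p) = _ := ratDeriv_algebraMap i p
  rw [dunkl, LinearMap.sub_apply, LinearMap.smul_apply, LinearMap.sum_apply, map_sub, h1,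
    algebraMap_smul_polyC, map_sum]
  congr 2
  refine Finset.sum_congr rfl fun j hj => ?_
  exact algebraMap_divDiff (Finset.ne_of_mem_erase hj).symm p

/-- If `T : Λ_N → ℂ[x]` is the restriction of a differential operator, so is `h T` for `h ∈ H_m`. -/
theorem exists_diffOp_polyRep {N : ℕ} {m : ℂ} (h : Cherednik N m) :
    ∀ (E : Module.End ℂ (RatFun N)) (T : PolyC N → PolyC N), E ∈ diffOps N →
      (∀ q ∈ symPoly N, E (algebraMap (PolyC N) (RatFun N) q) =
        algebraMap (PolyC N) (RatFun N) (T q)) →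
      ∃ E' ∈ diffOps N, ∀ q ∈ symPoly N, E' (algebraMap (PolyC N) (RatFun N) q) =
        algebraMap (PolyC N) (RatFun N) (polyRep N m h (T q)) := by
  -- For symmetric `q` one has `w(E q) = (w E w⁻¹) q`. This replaces the reflections in the Dunkl
  -- operators by conjugations of differential operators.
  have perm : ∀ (w : Equiv.Perm (Fin N)) (E : Module.End ℂ (RatFun N)) (T : PolyC N → PolyC N),
      (∀ q ∈ symPoly N, E (algebraMap (PolyC N) (RatFun N) q) =
        algebraMap (PolyC N) (RatFun N) (T q)) →
      ∀ q ∈ symPoly N, conjOp w E (algebraMap (PolyC N) (RatFun N) q) =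
        ratPerm w (algebraMap (PolyC N) (RatFun N) (T q)) := by
    intro w E T hT q hq
    rw [conjOp_apply, ratPerm_symm_symPoly w hq, hT q hq]
  induction h using Cherednik_induction with
  | hx i =>
    intro E T hE hT
    refine ⟨mulOp (ratX i) * E, mul_mem (mulOp_mem_diffOps _) hE, fun q hq => ?_⟩
    rw [polyRep_Hx, Module.End.mul_apply, hT q hq, LinearMap.mulLeft_apply, ratX, ← map_mul]
    rfl
  | hy i =>
    intro E T hE hT
    refine ⟨dOp i * E - m • ∑ j ∈ Finset.univ.erase i, mulOp (1 / (ratX i - ratX j)) *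
      (E - conjOp (Equiv.swap i j) E), ?_, fun q hq => ?_⟩
    · exact sub_mem (mul_mem (dOp_mem_diffOps i) hE) (Subalgebra.smul_mem _ (sum_mem fun j _ =>
        mul_mem (mulOp_mem_diffOps _) (sub_mem hE (conjOp_mem_diffOps _ hE))) m)
    · rw [polyRep_Hy, algebraMap_dunkl]
      simp only [LinearMap.sub_apply, LinearMap.smul_apply, LinearMap.sum_apply,
        Module.End.mul_apply, hT q hq, LinearMap.mulLeft_apply, perm _ E T hT q hq]
  | hw w =>
    intro E T hE hT
    refine ⟨conjOp w E, conjOp_mem_diffOps w hE, fun q hq => ?_⟩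
    rw [perm w E T hT q hq, polyRep_Hw, ratPerm_algebraMap, permOp_apply]
  | hscalar r =>
    intro E T hE hT
    refine ⟨r • E, Subalgebra.smul_mem _ hE r, fun q hq => ?_⟩
    rw [AlgHom.commutes, LinearMap.smul_apply, hT q hq, Module.algebraMap_end_apply,
      algebraMap_smul_polyC]
  -- A general `T` is needed here: `b` may carry `q` out of `Λ_N` before `a` acts.
  | hmul a b ha hb =>
    intro E T hE hT
    obtain ⟨E', hE', hT'⟩ := hb E T hE hT
    obtain ⟨E'', hE'', hT''⟩ := ha E' (fun q => polyRep N m b (T q)) hE' hT'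
    exact ⟨E'', hE'', fun q hq => by rw [hT'' q hq, map_mul, Module.End.mul_apply]⟩
  | hadd a b ha hb =>
    intro E T hE hT
    obtain ⟨E₁, hE₁, hT₁⟩ := ha E T hE hT
    obtain ⟨E₂, hE₂, hT₂⟩ := hb E T hE hT
    exact ⟨E₁ + E₂, add_mem hE₁ hE₂, fun q hq => by
      rw [LinearMap.add_apply, hT₁ q hq, hT₂ q hq, ← map_add, map_add (polyRep N m),
        LinearMap.add_apply]⟩

theorem IsRes.unique {N : ℕ} {m : ℂ} {h : Cherednik N m} {D E : Module.End ℂ (RatFun N)}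
    (hD : IsRes m h D) (hE : IsRes m h E) : D = E :=
  diffOps_ext hD.mem_diffOps hE.mem_diffOps fun q hq => by
    rw [hD.restrict q hq, hE.restrict q hq]

/-- For `h` commuting with `S_N` the invariance of `Res h` is automatic. -/
theorem isRes_of_restrict {N : ℕ} {m : ℂ} {h : Cherednik N m} (hh : h ∈ invariantSubalgebra N m)
    {D : Module.End ℂ (RatFun N)} (hD : D ∈ diffOps N)
    (hr : ∀ q ∈ symPoly N,
      D (algebraMap (PolyC N) (RatFun N) q) = algebraMap (PolyC N) (RatFun N) (polyRep N m h q)) :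
    IsRes m h D where
  mem_diffOps := hD
  restrict := hr
  invariant w f := by
    -- On `Λ_N` both sides agree because `h` preserves `Λ_N`; equality there suffices for
    -- differential operators.
    have e : conjOp w D = D := by
      refine diffOps_ext (conjOp_mem_diffOps w hD) hD fun q hq => ?_
      rw [conjOp_apply, ratPerm_symm_symPoly w hq, hr q hq,
        ratPerm_symPoly w (polyRep_mem_symPoly hh hq)]
    have := LinearMap.congr_fun e (ratPerm w f)
    rw [conjOp_apply, AlgEquiv.symm_apply_apply] at this
    exact this.symm

theorem exists_isRes {N : ℕ} {m : ℂ} {h : Cherednik N m} (hh : h ∈ invariantSubalgebra N m) :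
    ∃ D : Module.End ℂ (RatFun N), IsRes m h D := by
  obtain ⟨D, hD, hr⟩ := exists_diffOp_polyRep h 1 id (one_mem _) fun _ _ => rfl
  exact ⟨D, isRes_of_restrict hh hD hr⟩

theorem existsUnique_isRes {N : ℕ} {m : ℂ} {h : Cherednik N m}
    (hh : h ∈ invariantSubalgebra N m) : ∃! D : Module.End ℂ (RatFun N), IsRes m h D :=
  let ⟨D, hD⟩ := exists_isRes hh
  ⟨D, hD, fun _ hE => hE.unique hD⟩

/-- Invariance is essential: `D` is known to act as `a` only on symmetric polynomials, and `b` must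
map `Λ_N` to itself. -/
theorem IsRes.mul {N : ℕ} {m : ℂ} {a b : Cherednik N m} {D E : Module.End ℂ (RatFun N)}
    (ha : a ∈ invariantSubalgebra N m) (hb : b ∈ invariantSubalgebra N m)
    (hD : IsRes m a D) (hE : IsRes m b E) : IsRes m (a * b) (D * E) :=
  isRes_of_restrict (mul_mem ha hb) (mul_mem hD.mem_diffOps hE.mem_diffOps) fun q hq => by
    rw [Module.End.mul_apply, hE.restrict q hq, hD.restrict _ (polyRep_mem_symPoly hb hq), map_mul,
      Module.End.mul_apply]

theorem IsRes.add {N : ℕ} {m : ℂ} {a b : Cherednik N m} {D E : Module.End ℂ (RatFun N)}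
    (ha : a ∈ invariantSubalgebra N m) (hb : b ∈ invariantSubalgebra N m)
    (hD : IsRes m a D) (hE : IsRes m b E) : IsRes m (a + b) (D + E) :=
  isRes_of_restrict (add_mem ha hb) (add_mem hD.mem_diffOps hE.mem_diffOps) fun q hq => by
    rw [LinearMap.add_apply, hE.restrict q hq, hD.restrict q hq, ← map_add, map_add (polyRep N m),
      LinearMap.add_apply]

theorem isRes_algebraMap {N : ℕ} (m : ℂ) (r : ℂ) :
    IsRes m (algebraMap ℂ (Cherednik N m) r) (algebraMap ℂ (Module.End ℂ (RatFun N)) r) :=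
  isRes_of_restrict (algebraMap_mem _ r) (algebraMap_mem _ r) fun q _ => by
    rw [AlgHom.commutes, Module.algebraMap_end_apply, Module.algebraMap_end_apply,
      algebraMap_smul_polyC]

/-- The homomorphism `Res` on the elements of `H_m` commuting with `S_N`. -/
def resHom (N : ℕ) (m : ℂ) : invariantSubalgebra N m →ₐ[ℂ] Module.End ℂ (RatFun N) :=
  have spec : ∀ h : invariantSubalgebra N m, IsRes m (h : Cherednik N m)
      (exists_isRes h.2).choose := fun h => (exists_isRes h.2).choose_spec
  { toFun := fun h => (exists_isRes h.2).choose
    map_mul' := fun a b => (spec (a * b)).unique ((spec a).mul a.2 b.2 (spec b))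
    map_add' := fun a b => (spec (a + b)).unique ((spec a).add a.2 b.2 (spec b))
    map_one' := (spec 1).unique (by simpa using isRes_algebraMap (N := N) m 1)
    map_zero' := (spec 0).unique (by simpa using isRes_algebraMap (N := N) m 0)
    commutes' := fun r => (spec (algebraMap ℂ _ r)).unique (isRes_algebraMap m r) }

theorem isRes_resHom {N : ℕ} {m : ℂ} (h : invariantSubalgebra N m) :
    IsRes m (h : Cherednik N m) (resHom N m h) := (exists_isRes h.2).choose_spec

theorem IsRes.eq_resHom {N : ℕ} {m : ℂ} {h : Cherednik N m} {D : Module.End ℂ (RatFun N)}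
    (hD : IsRes m h D) (hh : h ∈ invariantSubalgebra N m) : D = resHom N m ⟨h, hh⟩ :=
  hD.unique (isRes_resHom ⟨h, hh⟩)

/-! ### The Calogero–Moser operator -/

theorem opL_mem_diffOps (N : ℕ) (m : ℂ) : opL N m ∈ diffOps N :=
  sub_mem (sum_mem fun i _ => mul_mem (dOp_mem_diffOps i) (dOp_mem_diffOps i))
    (sum_mem fun i _ => sum_mem fun j _ => mul_mem (mulOp_mem_diffOps _)
      (sub_mem (dOp_mem_diffOps i) (dOp_mem_diffOps j)))

theorem dunkl_symPoly {N : ℕ} (m : ℂ) (i : Fin N) {q : PolyC N} (hq : q ∈ symPoly N) :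
    dunkl m i q = MvPolynomial.pderiv i q := by
  apply IsFractionRing.injective (PolyC N) (RatFun N)
  rw [algebraMap_dunkl, Finset.sum_eq_zero, smul_zero, sub_zero]
  · exact ratDeriv_algebraMap i q
  · intro j _
    rw [ratPerm_symPoly _ hq, sub_self, mul_zero]

theorem one_div_sub_mul_sub_comm {K : Type*} [Field K] (a b c d : K) :
    1 / (b - a) * (d - c) = 1 / (a - b) * (c - d) := by
  rw [← neg_sub a b, ← neg_sub c d, one_div, one_div, inv_neg, neg_mul_neg]

/-- For symmetric `q`, `D_i q = ∂_i q` and `s_ij ∂_i q = ∂_j q`, so `D_i² q = ∂_i² q - m ∑_j (∂_i q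
- ∂_j q)/(x_i - x_j)`. The summand is symmetric in `i, j`; passing to `i < j` produces the factor
`2`. -/
theorem isRes_opL (N : ℕ) (m : ℂ) : IsRes m (HLap N m) (opL N m) := by
  refine isRes_of_restrict (HLap_mem_invariantSubalgebra N m) (opL_mem_diffOps N m) fun q hq => ?_
  have hd : ∀ i, dOp i (algebraMap (PolyC N) (RatFun N) q) =
      algebraMap (PolyC N) (RatFun N) (MvPolynomial.pderiv i q) := fun i => ratDeriv_algebraMap i q
  have hs : ∀ i j : Fin N, ratPerm (Equiv.swap i j)
      (algebraMap (PolyC N) (RatFun N) (MvPolynomial.pderiv i q)) =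
      algebraMap (PolyC N) (RatFun N) (MvPolynomial.pderiv j q) := by
    intro i j
    have h := LinearMap.congr_fun (permOp_pderiv (Equiv.swap i j) i) q
    rw [Equiv.swap_apply_left, Module.End.mul_apply, Module.End.mul_apply, permOp_symPoly _ hq] at h
    rw [ratPerm_algebraMap]
    exact congrArg _ h
  have hterm : ∀ i, algebraMap (PolyC N) (RatFun N) (polyRep N m (Hy m i ^ 2) q) =
      dOp i (dOp i (algebraMap (PolyC N) (RatFun N) q)) - m • ∑ j ∈ Finset.univ.erase i,
        1 / (ratX i - ratX j) * (dOp i (algebraMap (PolyC N) (RatFun N) q) -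
          dOp j (algebraMap (PolyC N) (RatFun N) q)) := by
    intro i
    rw [sq, map_mul, polyRep_Hy, Module.End.mul_apply, dunkl_symPoly m i hq, algebraMap_dunkl]
    simp only [hs, hd]
  rw [HLap, map_sum, LinearMap.sum_apply, map_sum, Finset.sum_congr rfl fun i _ => hterm i,
    Finset.sum_sub_distrib, opL, LinearMap.sub_apply, LinearMap.sum_apply, LinearMap.sum_apply]
  congr 1
  simp only [LinearMap.sum_apply, Module.End.mul_apply, LinearMap.mulLeft_apply,
    LinearMap.sub_apply]
  rw [← Finset.smul_sum]
  let F : Fin N → Fin N → RatFun N := fun i j => 1 / (ratX i - ratX j) *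
    (dOp i (algebraMap (PolyC N) (RatFun N) q) - dOp j (algebraMap (PolyC N) (RatFun N) q))
  have hF : ∀ i j, F j i = F i j := by
    intro i j
    exact one_div_sub_mul_sub_comm _ _ _ _
  have hsplit : ∀ i : Fin N, Finset.univ.erase i =
      Finset.univ.filter (fun j => i < j) ∪ Finset.univ.filter (fun j => j < i) := by
    intro i; ext j
    simp only [Finset.mem_erase, Finset.mem_univ, and_true, Finset.mem_union, Finset.mem_filter,
      true_and]
    exact ⟨fun h => (lt_or_gt_of_ne h).symm, fun h => h.elim ne_of_gt ne_of_lt⟩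
  have hsum : ∑ i, ∑ j ∈ Finset.univ.erase i, F i j =
      (2 : ℂ) • ∑ i, ∑ j ∈ Finset.univ.filter (fun j => i < j), F i j := by
    have hswap : ∑ i, ∑ j ∈ Finset.univ.filter (fun j => j < i), F i j =
        ∑ i, ∑ j ∈ Finset.univ.filter (fun j => i < j), F i j := by
      simp only [Finset.sum_filter]
      rw [Finset.sum_comm]
      simp only [hF]
    rw [Finset.sum_congr rfl fun i _ => by
      rw [hsplit i, Finset.sum_union (Finset.disjoint_filter.mpr fun j _ h => h.asymm)],
      Finset.sum_add_distrib, hswap, two_smul]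
  change _ = m • ∑ i, ∑ j ∈ Finset.univ.erase i, F i j
  rw [hsum, smul_smul, Finset.smul_sum]
  refine Finset.sum_congr rfl fun i _ => ?_
  rw [Finset.smul_sum]
  refine Finset.sum_congr rfl fun j _ => ?_
  simp only [F]
  rw [Algebra.smul_def, mul_comm m 2, ← mul_assoc, mul_one_div]

/-- `Res` intertwines the commutators with `∑ y_i^2` and with `L`. -/
theorem IsRes.halfComm_pow {N : ℕ} {m : ℂ} {h : Cherednik N m} {D : Module.End ℂ (RatFun N)}
    (hh : h ∈ invariantSubalgebra N m) (hD : IsRes m h D) (n : ℕ) :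
    (halfComm (HLap N m) ^ n) h ∈ invariantSubalgebra N m ∧
      IsRes m ((halfComm (HLap N m) ^ n) h) ((halfComm (opL N m) ^ n) D) := by
  have hL := HLap_mem_invariantSubalgebra N m
  induction n with
  | zero => exact ⟨hh, hD⟩
  | succ n ih =>
    obtain ⟨h1, h2⟩ := ih
    rw [pow_succ', pow_succ', Module.End.mul_apply, Module.End.mul_apply]
    set a := (halfComm (HLap N m) ^ n) h
    set E := (halfComm (opL N m) ^ n) D
    have hmem : halfComm (HLap N m) a ∈ invariantSubalgebra N m :=
      Subalgebra.smul_mem _ (sub_mem (mul_mem h1 hL) (mul_mem hL h1)) _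
    refine ⟨hmem, ?_⟩
    have e1 := h2.eq_resHom h1
    have e2 := (isRes_opL N m).eq_resHom hL
    have e3 : halfComm (opL N m) E = resHom N m ⟨_, hmem⟩ := by
      rw [halfComm_apply, e1, e2, ← map_mul, ← map_mul, ← map_sub, ← map_smul]
      rfl
    rw [e3]
    exact isRes_resHom ⟨_, hmem⟩

/-- `Res` of `γ(h)` is obtained from `Res h` by conjugation with `e^{L/2}`. -/
theorem IsRes.gammaAut {N : ℕ} {m : ℂ} {h : Cherednik N m} {D : Module.End ℂ (RatFun N)}
    (hh : h ∈ invariantSubalgebra N m) (hD : IsRes m h D) :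
    LocNilpotent (halfComm (opL N m)) D ∧
      IsRes m (LassalleNekrasov.gammaAut N m h) (locExp (halfComm (opL N m)) D) := by
  obtain ⟨⟨n, hn⟩, hγ⟩ := gammaAut_eq_locExp h
  -- The nilpotency at `h` passes to `D` because the only restriction of `0` is `0`.
  have hn' : (halfComm (opL N m) ^ n) D = 0 := by
    have h1 := (hD.halfComm_pow hh n).2
    rw [hn] at h1
    exact h1.unique (by simpa using isRes_algebraMap (N := N) m 0)
  refine ⟨⟨n, hn'⟩, ?_⟩
  rw [hγ, locExp_eq_sum hn, locExp_eq_sum hn']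
  have hsum : ∀ k, IsRes m
      (∑ l ∈ Finset.range k, (1 / (l.factorial : ℂ)) • (halfComm (HLap N m) ^ l) h)
      (∑ l ∈ Finset.range k, (1 / (l.factorial : ℂ)) • (halfComm (opL N m) ^ l) D) ∧
      ∑ l ∈ Finset.range k, (1 / (l.factorial : ℂ)) • (halfComm (HLap N m) ^ l) h ∈
        invariantSubalgebra N m := by
    intro k
    induction k with
    | zero => exact ⟨by simpa using isRes_algebraMap (N := N) m 0, by simp⟩
    | succ k ih =>
      obtain ⟨h1, h2⟩ := hD.halfComm_pow hh k
      have h3 : IsRes m ((1 / (k.factorial : ℂ)) • (halfComm (HLap N m) ^ k) h)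
          ((1 / (k.factorial : ℂ)) • (halfComm (opL N m) ^ k) D) := by
        have := (isRes_algebraMap (N := N) m (1 / (k.factorial : ℂ))).mul (algebraMap_mem _ _) h1 h2
        rwa [← Algebra.smul_def, ← Algebra.smul_def] at this
      rw [Finset.sum_range_succ, Finset.sum_range_succ]
      exact ⟨ih.1.add ih.2 (Subalgebra.smul_mem _ h1 _) h3,
        add_mem ih.2 (Subalgebra.smul_mem _ h1 _)⟩
  exact (hsum n).1

/-- `L` is locally nilpotent on symmetric polynomials. -/
theorem locNilpotent_opL_symPoly {N : ℕ} (m : ℂ) {q : PolyC N} (hq : q ∈ symPoly N) :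
    LocNilpotent (opL N m) (algebraMap (PolyC N) (RatFun N) q) := by
  have hone : polyRep N m (HLap N m) 1 = 0 := by
    rw [HLap, map_sum, LinearMap.sum_apply]
    refine Finset.sum_eq_zero fun i _ => ?_
    rw [sq, map_mul, polyRep_Hy, Module.End.mul_apply, dunkl_one, map_zero]
  -- Every polynomial is obtained from `1` by multiplications, so `q = h · 1`, and the nilpotency of
  -- the derivation at `h` can be used.
  obtain ⟨h, rfl⟩ : ∃ h : Cherednik N m, polyRep N m h 1 = q := by
    clear hq
    induction q using MvPolynomial.induction_on with
    | C a =>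
      refine ⟨algebraMap ℂ _ a, ?_⟩
      rw [AlgHom.commutes, Module.algebraMap_end_apply, MvPolynomial.smul_eq_C_mul, mul_one]
    | add p q hp hq =>
      obtain ⟨a, rfl⟩ := hp
      obtain ⟨b, rfl⟩ := hq
      exact ⟨a + b, by rw [map_add, LinearMap.add_apply]⟩
    | mul_X p i hp =>
      obtain ⟨a, rfl⟩ := hp
      refine ⟨Hx m i * a, ?_⟩
      rw [map_mul, polyRep_Hx, Module.End.mul_apply, mul_comm]
      rfl
  -- As `∑ y_i^2` kills `1`, the half commutator sends `h · 1` to `-½ ∑ y_i^2 (h · 1)`, whence the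
  -- factor `(-2)^n`. Symmetry is carried along because `L` and `∑ y_i^2` are compared only on
  -- `Λ_N`.
  have hpow : ∀ n, (opL N m ^ n) (algebraMap (PolyC N) (RatFun N) (polyRep N m h 1)) =
      algebraMap (PolyC N) (RatFun N) (polyRep N m ((-2 : ℂ) ^ n •
        (halfComm (HLap N m) ^ n) h) 1) ∧
      polyRep N m ((-2 : ℂ) ^ n • (halfComm (HLap N m) ^ n) h) 1 ∈ symPoly N := by
    intro n
    induction n with
    | zero => simpa using hq
    | succ n ih =>
      have e : polyRep N m ((-2 : ℂ) ^ (n + 1) • (halfComm (HLap N m) ^ (n + 1)) h) 1 =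
          polyRep N m (HLap N m) (polyRep N m ((-2 : ℂ) ^ n • (halfComm (HLap N m) ^ n) h) 1) := by
        rw [pow_succ' (halfComm _), Module.End.mul_apply, halfComm_apply, smul_smul,
          ← Module.End.mul_apply (polyRep N m (HLap N m)), ← map_mul]
        simp only [map_smul, map_sub, map_mul, LinearMap.smul_apply, LinearMap.sub_apply,
          Module.End.mul_apply, hone, map_zero, zero_sub]
        rw [smul_neg, ← neg_smul]
        congr 1
        rw [pow_succ]; ring
      rw [e]
      refine ⟨?_, polyRep_mem_symPoly (HLap_mem_invariantSubalgebra N m) ih.2⟩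
      rw [pow_succ', Module.End.mul_apply, ih.1, (isRes_opL N m).restrict _ ih.2]
  obtain ⟨n, hn⟩ := (gammaAut_eq_locExp h).1
  exact ⟨n, by rw [(hpow n).1, hn, smul_zero, map_zero, LinearMap.zero_apply, map_zero]⟩

/-! ## Symmetric polynomials and power sums -/

/-- Newton's identities express `k e_k` through power sums and smaller `e_j`, and `k` is invertible
in `ℂ`. -/
theorem esymm_mem_adjoin_psum (N k : ℕ) : MvPolynomial.esymm (Fin N) ℂ k ∈
    Algebra.adjoin ℂ (Set.range (MvPolynomial.psum (Fin N) ℂ)) := by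
  induction k using Nat.strong_induction_on with
  | _ k ih =>
    rcases Nat.eq_zero_or_pos k with rfl | hk
    · rw [MvPolynomial.esymm_zero]; exact one_mem _
    have h := MvPolynomial.mul_esymm_eq_sum (Fin N) ℂ k
    have hmem : (k : PolyC N) * MvPolynomial.esymm (Fin N) ℂ k ∈
        Algebra.adjoin ℂ (Set.range (MvPolynomial.psum (Fin N) ℂ)) := by
      rw [h]
      have hneg : ∀ n : ℕ, (-1 : PolyC N) ^ n ∈
          Algebra.adjoin ℂ (Set.range (MvPolynomial.psum (Fin N) ℂ)) := fun n =>
        pow_mem (neg_mem (one_mem _)) n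
      refine mul_mem (hneg _) (sum_mem fun a ha => mul_mem (mul_mem (hneg _) (ih _ ?_))
        (Algebra.subset_adjoin ⟨_, rfl⟩))
      exact (Finset.mem_filter.mp ha).2
    have hk0 : (k : ℂ) ≠ 0 := by exact_mod_cast hk.ne'
    have := Subalgebra.smul_mem _ hmem (k : ℂ)⁻¹
    rwa [← nsmul_eq_mul, ← Nat.cast_smul_eq_nsmul ℂ, smul_smul, inv_mul_cancel₀ hk0,
      one_smul] at this

/-- A symmetric polynomial is a combination of products of power sums of degree at most its
degree. -/
theorem symPoly_mem_span_psum {N : ℕ} {q : PolyC N} (hq : q ∈ symPoly N) :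
    q ∈ Submodule.span ℂ {u : PolyC N | ∃ s : List ℕ, s.sum ≤ q.totalDegree ∧
      u = (s.map (MvPolynomial.psum (Fin N) ℂ)).prod} := by
  have h1 : q ∈ Algebra.adjoin ℂ (Set.range (MvPolynomial.psum (Fin N) ℂ)) := by
    obtain ⟨r, hr⟩ := MvPolynomial.esymmAlgHom_surjective (σ := Fin N) ℂ (n := N) (by simp) ⟨q, hq⟩
    have hr' : MvPolynomial.aeval (fun i : Fin N => MvPolynomial.esymm (Fin N) ℂ (i + 1)) r = q := by
      rw [← MvPolynomial.esymmAlgHom_apply, hr]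
    rw [← hr']
    induction r using MvPolynomial.induction_on generalizing q with
    | C a => rw [MvPolynomial.aeval_C]; exact algebraMap_mem _ a
    | add a b ha hb =>
      rw [map_add]
      exact add_mem (ha (SetLike.coe_mem _) rfl (MvPolynomial.esymmAlgHom_apply ..).symm)
        (hb (SetLike.coe_mem _) rfl (MvPolynomial.esymmAlgHom_apply ..).symm)
    | mul_X a i ha =>
      rw [map_mul, MvPolynomial.aeval_X]
      exact mul_mem (ha (SetLike.coe_mem _) rfl (MvPolynomial.esymmAlgHom_apply ..).symm)
        (esymm_mem_adjoin_psum N _)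
  have h2 : q ∈ Submodule.span ℂ {u : PolyC N | ∃ s : List ℕ,
      u = (s.map (MvPolynomial.psum (Fin N) ℂ)).prod} := by
    rw [← Subalgebra.mem_toSubmodule, Algebra.adjoin_eq_span] at h1
    refine Submodule.span_mono ?_ h1
    intro u hu
    induction hu using Submonoid.closure_induction with
    | mem u hu =>
      obtain ⟨k, rfl⟩ := hu
      exact ⟨[k], by simp⟩
    | one => exact ⟨[], by simp⟩
    | mul a b _ _ ha hb =>
      obtain ⟨s, rfl⟩ := ha
      obtain ⟨t, rfl⟩ := hb
      exact ⟨s ++ t, by simp⟩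
  -- Truncation to degrees at most `deg q` fixes `q` and, by homogeneity, either keeps or kills each
  -- product of power sums. This gives the degree bound.
  let H : PolyC N →ₗ[ℂ] PolyC N :=
    ∑ k ∈ Finset.range (q.totalDegree + 1), MvPolynomial.homogeneousComponent k
  have hH : H q = q := by
    simp only [H, LinearMap.sum_apply]
    exact MvPolynomial.sum_homogeneousComponent q
  have hprod : ∀ s : List ℕ,
      ((s.map (MvPolynomial.psum (Fin N) ℂ)).prod).IsHomogeneous s.sum := by
    intro s
    induction s with
    | nil => exact MvPolynomial.isHomogeneous_one _ _
    | cons k s ih =>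
      rw [List.map_cons, List.prod_cons, List.sum_cons]
      refine MvPolynomial.IsHomogeneous.mul ?_ ih
      exact MvPolynomial.IsHomogeneous.sum _ _ _ fun i _ => by
        simpa using (MvPolynomial.isHomogeneous_X ℂ i).pow k
  suffices h : H q ∈ Submodule.span ℂ {u : PolyC N | ∃ s : List ℕ, s.sum ≤ q.totalDegree ∧
      u = (s.map (MvPolynomial.psum (Fin N) ℂ)).prod} by rwa [hH] at h
  refine Submodule.span_induction (p := fun x _ => H x ∈ Submodule.span ℂ {u : PolyC N |
    ∃ s : List ℕ, s.sum ≤ q.totalDegree ∧ u = (s.map (MvPolynomial.psum (Fin N) ℂ)).prod})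
    ?_ ?_ ?_ ?_ h2
  · rintro _ ⟨s, rfl⟩
    simp only [H, LinearMap.sum_apply, MvPolynomial.homogeneousComponent_of_mem (hprod s),
      Finset.sum_ite_eq', Finset.mem_range]
    split_ifs with h
    · exact Submodule.subset_span ⟨s, by omega, rfl⟩
    · exact zero_mem _
  · rw [map_zero]; exact zero_mem _
  · intro x y _ _ hx hy; rw [map_add]; exact add_mem hx hy
  · intro c x _ hx; rw [map_smul]; exact Submodule.smul_mem _ c hx

/-- The index `i` ensures that there is a variable; with none, power sums of positive exponent
vanish. -/
theorem le_totalDegree_psum {N : ℕ} (i : Fin N) (k : ℕ) :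
    k ≤ (MvPolynomial.psum (Fin N) ℂ k).totalDegree := by
  rcases Nat.eq_zero_or_pos k with rfl | hk
  · exact Nat.zero_le _
  have hc : MvPolynomial.coeff (Finsupp.single i k) (MvPolynomial.psum (Fin N) ℂ k) = 1 := by
    rw [MvPolynomial.psum, MvPolynomial.coeff_sum, Finset.sum_eq_single_of_mem i (Finset.mem_univ i)]
    · rw [MvPolynomial.coeff_X_pow, if_pos rfl]
    · intro j _ hj
      rw [MvPolynomial.coeff_X_pow, if_neg]
      intro e
      exact hj ((Finsupp.single_left_inj hk.ne').mp e)
  have := MvPolynomial.le_totalDegree (p := MvPolynomial.psum (Fin N) ℂ k)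
    (s := Finsupp.single i k) (by rw [MvPolynomial.mem_support_iff, hc]; exact one_ne_zero)
  simpa using this

/-! ## Noncommutative polynomials -/

/-- The noncommutative monomial with the given letters. -/
def word {N : ℕ} (s : List (Fin N)) : FreeAlgebra ℂ (Fin N) := (s.map (FreeAlgebra.ι ℂ)).prod

theorem word_append {N : ℕ} (s t : List (Fin N)) : word (s ++ t) = word s * word t := by
  simp [word]

/-- Noncommutative polynomials of degree less than `d`. -/
def wordsLT (N d : ℕ) : Submodule ℂ (FreeAlgebra ℂ (Fin N)) :=
  Submodule.span ℂ {u | ∃ s : List (Fin N), s.length < d ∧ u = word s}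

theorem word_mem_wordsLT {N d : ℕ} {s : List (Fin N)} (h : s.length < d) : word s ∈ wordsLT N d :=
  Submodule.subset_span ⟨s, h, rfl⟩

theorem wordsLT_mono {N : ℕ} {d e : ℕ} (h : d ≤ e) : wordsLT N d ≤ wordsLT N e :=
  Submodule.span_mono fun _ ⟨s, hs, hu⟩ => ⟨s, hs.trans_le h, hu⟩

theorem wordsLT_mul {N : ℕ} {a b : ℕ} {P Q : FreeAlgebra ℂ (Fin N)}
    (hP : P ∈ wordsLT N (a + 1)) (hQ : Q ∈ wordsLT N (b + 1)) : P * Q ∈ wordsLT N (a + b + 1) := by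
  have h : wordsLT N (a + 1) * wordsLT N (b + 1) ≤ wordsLT N (a + b + 1) := by
    rw [wordsLT, wordsLT, Submodule.span_mul_span, Submodule.span_le]
    rintro _ ⟨_, ⟨s, hs, rfl⟩, _, ⟨t, ht, rfl⟩, rfl⟩
    refine Submodule.subset_span ⟨s ++ t, ?_, (word_append s t).symm⟩
    rw [List.length_append]; omega
  exact h (Submodule.mul_mem_mul hP hQ)

theorem span_word_eq_wordsLT (N d : ℕ) :
    Submodule.span ℂ {u : FreeAlgebra ℂ (Fin N) |
      ∃ s : List (Fin N), s.length ≤ d ∧ u = (s.map (FreeAlgebra.ι ℂ)).prod} =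
      wordsLT N (d + 1) := by
  simp only [wordsLT, word, Nat.lt_succ_iff]

theorem IsOrdering.mem_wordsLT {N : ℕ} {p : PolyC N} {P : FreeAlgebra ℂ (Fin N)}
    (h : IsOrdering p P) : P ∈ wordsLT N (p.totalDegree + 1) :=
  span_word_eq_wordsLT N p.totalDegree ▸ h.degree_le

/-- Letters become commuting variables. -/
abbrev abel (N : ℕ) : FreeAlgebra ℂ (Fin N) →ₐ[ℂ] PolyC N :=
  FreeAlgebra.lift ℂ fun i => (MvPolynomial.X i : PolyC N)

/-- The action of permutations on noncommutative polynomials. -/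
abbrev permWord {N : ℕ} (w : Equiv.Perm (Fin N)) :
    FreeAlgebra ℂ (Fin N) →ₐ[ℂ] FreeAlgebra ℂ (Fin N) :=
  FreeAlgebra.lift ℂ fun i => FreeAlgebra.ι ℂ (w i)

theorem permWord_word {N : ℕ} (w : Equiv.Perm (Fin N)) (s : List (Fin N)) :
    permWord w (word s) = word (s.map w) := by
  simp only [word, map_list_prod, List.map_map]
  congr 2
  funext i
  simp

theorem permWord_mem_wordsLT {N d : ℕ} (w : Equiv.Perm (Fin N)) {P : FreeAlgebra ℂ (Fin N)}
    (hP : P ∈ wordsLT N d) : permWord w P ∈ wordsLT N d := by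
  have h : wordsLT N d ≤ (wordsLT N d).comap (permWord w).toLinearMap := by
    refine Submodule.span_le.mpr ?_
    rintro _ ⟨s, hs, rfl⟩
    change permWord w (word s) ∈ wordsLT N d
    rw [permWord_word]
    exact word_mem_wordsLT (by rwa [List.length_map])
  exact h hP

theorem permWord_permWord {N : ℕ} (v w : Equiv.Perm (Fin N)) (P : FreeAlgebra ℂ (Fin N)) :
    permWord v (permWord w P) = permWord (v * w) P := by
  have : (permWord v).comp (permWord w) = permWord (v * w) := by
    apply FreeAlgebra.hom_ext
    funext i
    simp
  exact DFunLike.congr_fun this P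

theorem abel_permWord {N : ℕ} (w : Equiv.Perm (Fin N)) (P : FreeAlgebra ℂ (Fin N)) :
    abel N (permWord w P) = MvPolynomial.rename w (abel N P) := by
  have : (abel N).comp (permWord w) = (MvPolynomial.rename w).comp (abel N) := by
    apply FreeAlgebra.hom_ext
    funext i
    simp
  exact DFunLike.congr_fun this P

/-- Averaging over permutations of the letters. -/
def avgWord {N : ℕ} (P : FreeAlgebra ℂ (Fin N)) : FreeAlgebra ℂ (Fin N) :=
  ((N.factorial : ℂ)⁻¹) • ∑ w : Equiv.Perm (Fin N), permWord w P

theorem permWord_avgWord {N : ℕ} (v : Equiv.Perm (Fin N)) (P : FreeAlgebra ℂ (Fin N)) :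
    permWord v (avgWord P) = avgWord P := by
  rw [avgWord, map_smul, map_sum]
  simp only [permWord_permWord]
  congr 1
  exact Equiv.sum_comp (Equiv.mulLeft v) fun w => permWord w P

theorem avgWord_mem_wordsLT {N d : ℕ} {P : FreeAlgebra ℂ (Fin N)} (hP : P ∈ wordsLT N d) :
    avgWord P ∈ wordsLT N d :=
  Submodule.smul_mem _ _ (sum_mem fun w _ => permWord_mem_wordsLT w hP)

theorem factorial_smul_const {V : Type*} [AddCommGroup V] [Module ℂ V] (N : ℕ) (v : V) :
    ((N.factorial : ℂ)⁻¹) • ∑ _w : Equiv.Perm (Fin N), v = v := by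
  rw [Finset.sum_const, Finset.card_univ, Fintype.card_perm, Fintype.card_fin,
    ← Nat.cast_smul_eq_nsmul ℂ, smul_smul, inv_mul_cancel₀, one_smul]
  exact_mod_cast N.factorial_ne_zero

theorem abel_word {N : ℕ} (s : List (Fin N)) :
    abel N (word s) = MvPolynomial.monomial (Multiset.toFinsupp (s : Multiset (Fin N))) 1 := by
  induction s with
  | nil => simp [word]
  | cons i s ih =>
    have e : word (i :: s) = FreeAlgebra.ι ℂ i * word s := by simp [word]
    rw [e, map_mul, ih, FreeAlgebra.lift_ι_apply, MvPolynomial.X, MvPolynomial.monomial_mul, one_mul,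
      ← Multiset.cons_coe, ← Multiset.singleton_add, map_add, Multiset.toFinsupp_singleton]

theorem totalDegree_abel_le {N d : ℕ} {P : FreeAlgebra ℂ (Fin N)} (hP : P ∈ wordsLT N (d + 1)) :
    (abel N P).totalDegree ≤ d := by
  rw [← MvPolynomial.mem_restrictTotalDegree]
  have h : wordsLT N (d + 1) ≤
      (MvPolynomial.restrictTotalDegree (Fin N) ℂ d).comap (abel N).toLinearMap := by
    refine Submodule.span_le.mpr ?_
    rintro _ ⟨s, hs, rfl⟩
    change abel N (word s) ∈ MvPolynomial.restrictTotalDegree (Fin N) ℂ d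
    rw [MvPolynomial.mem_restrictTotalDegree, abel_word]
    refine (MvPolynomial.totalDegree_monomial_le _ _).trans ?_
    have e := Multiset.toFinsupp_sum_eq (s : Multiset (Fin N))
    rw [Multiset.coe_card] at e
    omega
  exact h hP

/-- Ordering of the letters in some standard way. -/
def stdOrder (N : ℕ) : PolyC N →ₗ[ℂ] FreeAlgebra ℂ (Fin N) :=
  (MvPolynomial.basisMonomials (Fin N) ℂ).constr ℂ fun a => word (Finsupp.toMultiset a).toList

theorem stdOrder_monomial {N : ℕ} (a : Fin N →₀ ℕ) :
    stdOrder N (MvPolynomial.monomial a 1) = word (Finsupp.toMultiset a).toList := by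
  have := (MvPolynomial.basisMonomials (Fin N) ℂ).constr_basis ℂ
    (fun a => word (Finsupp.toMultiset a).toList) a
  rwa [MvPolynomial.coe_basisMonomials] at this

theorem monomial_eq_smul_one {N : ℕ} (a : Fin N →₀ ℕ) (c : ℂ) :
    (MvPolynomial.monomial a c : PolyC N) = c • MvPolynomial.monomial a 1 := by
  rw [MvPolynomial.smul_monomial, smul_eq_mul, mul_one]

theorem abel_stdOrder {N : ℕ} (p : PolyC N) : abel N (stdOrder N p) = p := by
  have h : (abel N).toLinearMap ∘ₗ stdOrder N = LinearMap.id := by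
    apply (MvPolynomial.basisMonomials (Fin N) ℂ).ext
    intro a
    rw [MvPolynomial.coe_basisMonomials, LinearMap.comp_apply, stdOrder_monomial]
    change abel N (word _) = _
    rw [abel_word, Multiset.coe_toList, Finsupp.toMultiset_toFinsupp]
    rfl
  exact LinearMap.congr_fun h p

theorem stdOrder_mem_wordsLT {N : ℕ} (p : PolyC N) :
    stdOrder N p ∈ wordsLT N (p.totalDegree + 1) := by
  have e : stdOrder N p = ∑ a ∈ p.support,
      stdOrder N (MvPolynomial.monomial a (MvPolynomial.coeff a p)) := by
    rw [← map_sum, ← p.as_sum]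
  rw [e]
  refine sum_mem fun a ha => ?_
  rw [monomial_eq_smul_one, map_smul, stdOrder_monomial]
  refine Submodule.smul_mem _ _ (word_mem_wordsLT ?_)
  rw [Multiset.length_toList, Finsupp.card_toMultiset]
  exact Nat.lt_succ_of_le (MvPolynomial.le_totalDegree ha)

/-- Averaging an arbitrary ordering makes it invariant, keeps its degree bound, and still gives `p`
on commuting letters because `p` is symmetric. -/
theorem exists_isOrdering {N : ℕ} {p : PolyC N} (hp : p ∈ symPoly N) :
    ∃ P : FreeAlgebra ℂ (Fin N), IsOrdering p P := by
  refine ⟨avgWord (stdOrder N p), ?_, fun w => permWord_avgWord w _, ?_⟩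
  · change abel N _ = p
    rw [avgWord, map_smul, map_sum]
    simp only [abel_permWord, abel_stdOrder]
    rw [Finset.sum_congr rfl fun w _ => (MvPolynomial.mem_symmetricSubalgebra p).mp hp w,
      factorial_smul_const]
  · rw [span_word_eq_wordsLT]
    exact avgWord_mem_wordsLT (stdOrder_mem_wordsLT p)

/-! ## The action of polynomials in the `π_i` on symmetric polynomials -/

/-- The action of `P(π_1, …, π_N)` on symmetric polynomials. -/
def piAct {N : ℕ} (m : ℂ) : FreeAlgebra ℂ (Fin N) →ₗ[ℂ] (symPoly N →ₗ[ℂ] PolyC N) :=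
  LinearMap.lcomp ℂ (PolyC N) (symPoly N).val.toLinearMap ∘ₗ
    (polyRep N m).toLinearMap ∘ₗ (FreeAlgebra.lift ℂ (Hpi m)).toLinearMap

theorem piAct_apply {N : ℕ} (m : ℂ) (P : FreeAlgebra ℂ (Fin N)) (q : symPoly N) :
    piAct m P q = polyRep N m (evalPi m P) q := rfl

theorem evalPi_mul {N : ℕ} (m : ℂ) (P Q : FreeAlgebra ℂ (Fin N)) :
    evalPi m (P * Q) = evalPi m P * evalPi m Q := map_mul _ _ _

/-- The commutator of `π_i` and `π_j` leaves a transposition. Moved to the right through `v` it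
permutes the letters of `v`, and it then disappears on a symmetric polynomial; the words that remain
are one letter shorter. -/
theorem piAct_swap {N : ℕ} (m : ℂ) (u v : List (Fin N)) (i j : Fin N) :
    piAct m (word (u ++ i :: j :: v)) - piAct m (word (u ++ j :: i :: v)) =
      m • (piAct m (word (u ++ i :: v.map (Equiv.swap i j))) -
        piAct m (word (u ++ j :: v.map (Equiv.swap i j)))) := by
  have hcons : ∀ (i : Fin N) (v : List (Fin N)), word (i :: v) = FreeAlgebra.ι ℂ i * word v :=
    fun i v => by simp [word]
  have hι : ∀ i : Fin N, evalPi m (FreeAlgebra.ι ℂ i) = Hpi m i := fun i =>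
    FreeAlgebra.lift_ι_apply _ _
  ext1 q
  have hw : ∀ h : Cherednik N m, polyRep N m (h * Hw m (Equiv.swap i j)) (q : PolyC N) =
      polyRep N m h q := by
    intro h
    rw [map_mul, Module.End.mul_apply, polyRep_Hw, permOp_symPoly _ q.2]
  simp only [LinearMap.sub_apply, LinearMap.smul_apply, piAct_apply, word_append, hcons,
    evalPi_mul, hι]
  rw [← LinearMap.sub_apply, ← LinearMap.sub_apply, ← map_sub, ← map_sub]
  have e1 : evalPi m (word u) * (Hpi m i * (Hpi m j * evalPi m (word v))) -
      evalPi m (word u) * (Hpi m j * (Hpi m i * evalPi m (word v))) =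
      evalPi m (word u) * ((Hpi m i * Hpi m j - Hpi m j * Hpi m i) * evalPi m (word v)) := by
    simp only [mul_sub, sub_mul, mul_assoc]
  have e2 : Hw m (Equiv.swap i j) * evalPi m (word v) =
      evalPi m (word (v.map (Equiv.swap i j))) * Hw m (Equiv.swap i j) := by
    rw [Hw_mul_evalPi, ← permWord_word]
  rw [e1, Hpi_commutator, smul_mul_assoc, mul_smul_comm, map_smul, LinearMap.smul_apply,
    mul_assoc (Hpi m i - Hpi m j), e2, ← mul_assoc, ← mul_assoc, hw]
  simp only [mul_sub, sub_mul, mul_assoc]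

/-- Reordering the letters changes the action by polynomials of smaller degree. -/
theorem piAct_perm {N : ℕ} (m : ℂ) {d : ℕ} {s t : List (Fin N)} (h : s.Perm t) :
    ∀ u : List (Fin N), (u ++ s).length < d + 1 →
      piAct m (word (u ++ s)) - piAct m (word (u ++ t)) ∈ (wordsLT N d).map (piAct m) := by
  induction h with
  | nil => intro u _; rw [sub_self]; exact zero_mem _
  -- The common first letter is moved into the prefix `u`, which is why the claim is made for all
  -- prefixes.
  | cons x _ ih =>
    intro u hu
    have := ih (u ++ [x]) (by simpa using hu)
    simpa using this
  | swap x y l =>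
    intro u hu
    simp only [List.length_append, List.length_cons] at hu
    rw [piAct_swap]
    refine Submodule.smul_mem _ m (sub_mem (Submodule.mem_map_of_mem (word_mem_wordsLT ?_))
      (Submodule.mem_map_of_mem (word_mem_wordsLT ?_)))
    all_goals
      simp only [List.length_append, List.length_cons, List.length_map]
      omega
  | trans h₁ _ ih₁ ih₂ =>
    intro u hu
    have := add_mem (ih₁ u hu) (ih₂ u (by rwa [List.length_append, ← h₁.length_eq,
      ← List.length_append]))
    rwa [sub_add_sub_cancel] at this

theorem piAct_sub_stdOrder {N : ℕ} (m : ℂ) {d : ℕ} {P : FreeAlgebra ℂ (Fin N)}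
    (hP : P ∈ wordsLT N (d + 1)) :
    piAct m P - piAct m (stdOrder N (abel N P)) ∈ (wordsLT N d).map (piAct m) := by
  have h : wordsLT N (d + 1) ≤ ((wordsLT N d).map (piAct m)).comap
      (piAct m - piAct m ∘ₗ stdOrder N ∘ₗ (abel N).toLinearMap) := by
    refine Submodule.span_le.mpr ?_
    rintro _ ⟨s, hs, rfl⟩
    change piAct m (word s) - piAct m (stdOrder N (abel N (word s))) ∈
      (wordsLT N d).map (piAct m)
    rw [abel_word, stdOrder_monomial, Multiset.toFinsupp_toMultiset]
    exact piAct_perm m (Multiset.coe_eq_coe.mp (Multiset.coe_toList (s : Multiset (Fin N))).symm) []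
      (by simpa using hs)
  exact h hP

theorem piAct_sub_mem_of_abel_eq {N : ℕ} (m : ℂ) {d : ℕ} {P Q : FreeAlgebra ℂ (Fin N)}
    (hP : P ∈ wordsLT N (d + 1)) (hQ : Q ∈ wordsLT N (d + 1)) (h : abel N P = abel N Q) :
    piAct m P - piAct m Q ∈ (wordsLT N d).map (piAct m) := by
  have := sub_mem (piAct_sub_stdOrder m hP) (piAct_sub_stdOrder m hQ)
  rwa [h, sub_sub_sub_cancel_right] at this

/-- Averaging does not change an action by symmetric polynomials. -/
theorem piAct_avgWord {N : ℕ} (m : ℂ) {P : FreeAlgebra ℂ (Fin N)}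
    (h : ∀ q, piAct m P q ∈ symPoly N) : piAct m (avgWord P) = piAct m P := by
  ext1 q
  -- Moving `w` to the right gives `w(P(π) q) = (wP)(π) q`, and `P(π) q` is symmetric by hypothesis.
  have hw : ∀ w : Equiv.Perm (Fin N), piAct m (permWord w P) q = piAct m P q := by
    intro w
    have e := congrArg (fun a => polyRep N m a (q : PolyC N)) (Hw_mul_evalPi m w P)
    simp only [map_mul, Module.End.mul_apply, polyRep_Hw, permOp_symPoly w q.2] at e
    rw [piAct_apply, piAct_apply, ← e]
    exact permOp_symPoly w (h q)
  rw [avgWord, map_smul, map_sum, LinearMap.smul_apply, LinearMap.sum_apply,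
    Finset.sum_congr rfl fun w _ => hw w, factorial_smul_const]

/-- A combination of products of power sums equal to `p` is lifted by replacing each power sum with
`∑ π_i^k`. Bounding the degrees of these products by `deg p` controls the length of the words. -/
theorem exists_evalPi_mem_algT {N : ℕ} (m : ℂ) {p : PolyC N} (hp : p ∈ symPoly N) :
    ∃ Q ∈ wordsLT N (p.totalDegree + 1), abel N Q = p ∧ evalPi m Q ∈ algT N m := by
  let S : Submodule ℂ (FreeAlgebra ℂ (Fin N)) := wordsLT N (p.totalDegree + 1) ⊓
    (Subalgebra.toSubmodule (algT N m)).comap (FreeAlgebra.lift ℂ (Hpi m)).toLinearMap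
  have h : Submodule.span ℂ {u : PolyC N | ∃ s : List ℕ, s.sum ≤ p.totalDegree ∧
      u = (s.map (MvPolynomial.psum (Fin N) ℂ)).prod} ≤ S.map (abel N).toLinearMap := by
    refine Submodule.span_le.mpr ?_
    rintro _ ⟨s, hs, rfl⟩
    have key : ∀ s : List ℕ, ∃ Q ∈ wordsLT N (s.sum + 1),
        abel N Q = (s.map (MvPolynomial.psum (Fin N) ℂ)).prod ∧ evalPi m Q ∈ algT N m := by
      intro s
      induction s with
      | nil =>
        refine ⟨1, word_mem_wordsLT (s := []) (by simp), by simp, ?_⟩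
        rw [evalPi, map_one]; exact one_mem _
      | cons k s ih =>
        obtain ⟨Q, h1, h2, h3⟩ := ih
        refine ⟨(∑ i, FreeAlgebra.ι ℂ i ^ k) * Q, ?_, ?_, ?_⟩
        · rw [List.sum_cons]
          refine wordsLT_mul (sum_mem fun i _ => ?_) h1
          have e : FreeAlgebra.ι ℂ i ^ k = word (List.replicate k i) := by simp [word]
          rw [e]
          exact word_mem_wordsLT (by simp)
        · rw [map_mul, h2, List.map_cons, List.prod_cons, map_sum]
          simp [MvPolynomial.psum]
        · rw [evalPi_mul]
          refine mul_mem (Algebra.subset_adjoin ⟨k, ?_⟩) h3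
          simp [evalPi]
    obtain ⟨Q, h1, h2, h3⟩ := key s
    exact ⟨Q, ⟨wordsLT_mono (by omega) h1, h3⟩, h2⟩
  obtain ⟨Q, ⟨h1, h2⟩, h3⟩ := h (symPoly_mem_span_psum hp)
  exact ⟨Q, h1, h3, h2⟩

/-- An invariant polynomial in the `π_i` acts on symmetric polynomials as an element of `𝒯`. -/
theorem exists_algT_action {N : ℕ} (m : ℂ) (d : ℕ) :
    ∀ P ∈ wordsLT N d, (∀ w, permWord w P = P) →
      ∃ t ∈ algT N m, ∀ q ∈ symPoly N, polyRep N m (evalPi m P) q = polyRep N m t q := by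
  induction d with
  | zero =>
    intro P hP _
    have h0 : P = 0 := by simpa [wordsLT] using hP
    exact ⟨0, zero_mem _, fun q _ => by rw [h0, evalPi, map_zero]⟩
  | succ d ih =>
    intro P hP hinv
    have hsymm : abel N P ∈ symPoly N := mem_symPoly_of_permOp fun w => by
      rw [permOp_apply, ← abel_permWord, hinv]
    -- `Q` and `P` have the same commutative image, so on `Λ_N` they differ by the action of some
    -- `R` of smaller degree.
    obtain ⟨Q, hQ, hQP, hQT⟩ := exists_evalPi_mem_algT m hsymm
    have hQ' := wordsLT_mono (Nat.succ_le_succ (totalDegree_abel_le hP)) hQ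
    obtain ⟨R, hR, hRPQ⟩ := piAct_sub_mem_of_abel_eq m hP hQ' hQP.symm
    -- `R` itself need not be invariant, but its action preserves `Λ_N`, so it can be averaged
    -- before the induction hypothesis is used.
    have hRsymm : ∀ q, piAct m R q ∈ symPoly N := by
      intro q
      rw [hRPQ, LinearMap.sub_apply, piAct_apply, piAct_apply]
      exact sub_mem (polyRep_mem_symPoly (evalPi_mem_invariantSubalgebra m hinv) q.2)
        (polyRep_mem_symPoly (algT_le_invariantSubalgebra N m hQT) q.2)
    obtain ⟨t, ht, hact⟩ := ih (avgWord R) (avgWord_mem_wordsLT hR) fun w => permWord_avgWord w R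
    refine ⟨t + evalPi m Q, add_mem ht hQT, fun q hq => ?_⟩
    have h1 := LinearMap.congr_fun ((piAct_avgWord m hRsymm).trans hRPQ) ⟨q, hq⟩
    rw [piAct_apply, hact q hq, LinearMap.sub_apply, piAct_apply, piAct_apply] at h1
    rw [map_add, LinearMap.add_apply, h1, sub_add_cancel]

/-! ## Quantum integrals -/

theorem isOrdering_powerSum (N k : ℕ) : IsOrdering (MvPolynomial.psum (Fin N) ℂ k)
    (∑ i : Fin N, FreeAlgebra.ι ℂ i ^ k) where
  lifts := by simp [MvPolynomial.psum]
  invariant w := by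
    simp only [map_sum, map_pow, FreeAlgebra.lift_ι_apply]
    exact Equiv.sum_comp w fun i => FreeAlgebra.ι ℂ i ^ k
  degree_le := by
    rw [span_word_eq_wordsLT]
    refine sum_mem fun i _ => ?_
    have e : FreeAlgebra.ι ℂ i ^ k = word (List.replicate k i) := by simp [word]
    rw [e]
    refine word_mem_wordsLT ?_
    rw [List.length_replicate]
    exact Nat.lt_succ_of_le (le_totalDegree_psum i k)

theorem evalPi_powerSum {N : ℕ} (m : ℂ) (k : ℕ) :
    evalPi m (∑ i : Fin N, FreeAlgebra.ι ℂ i ^ k) = ∑ i : Fin N, Hpi m i ^ k := by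
  simp [evalPi]

theorem psum_mem_symPoly (N k : ℕ) : MvPolynomial.psum (Fin N) ℂ k ∈ symPoly N :=
  (MvPolynomial.mem_symmetricSubalgebra _).mpr (MvPolynomial.psum_isSymmetric (Fin N) ℂ k)

/-- `P(π_1, …, π_N)` need not lie in `𝒯`; an element of `𝒯` with the same action on `Λ_N` has the
same restriction. -/
theorem IsTrigIntegral.exists_algT {N : ℕ} {m : ℂ} {p : PolyC N} {D : Module.End ℂ (RatFun N)}
    (h : IsTrigIntegral m p D) : ∃ t ∈ algT N m, IsRes m t D := by
  obtain ⟨P, hP, hD⟩ := h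
  obtain ⟨t, ht, hact⟩ := exists_algT_action m _ P hP.mem_wordsLT hP.invariant
  refine ⟨t, ht, isRes_of_restrict (algT_le_invariantSubalgebra N m ht) hD.mem_diffOps
    fun q hq => ?_⟩
  rw [hD.restrict q hq, hact q hq]

/-- The proof uses the ordering and not the element of `𝒯` from `IsTrigIntegral.exists_algT`,
because the ordering carries the degree bound. -/
theorem IsTrigIntegral.halfComm_pow_eq_zero {N : ℕ} {m : ℂ} {p : PolyC N}
    {D : Module.End ℂ (RatFun N)} (h : IsTrigIntegral m p D) :
    (halfComm (opL N m) ^ (p.totalDegree + 1)) D = 0 := by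
  obtain ⟨P, hP, hD⟩ := h
  have h1 := (hD.halfComm_pow (evalPi_mem_invariantSubalgebra m hP.invariant)
    (p.totalDegree + 1)).2
  rw [halfComm_pow_evalPi m hP.degree_le] at h1
  exact h1.unique (by simpa using isRes_algebraMap (N := N) m 0)

theorem IsTrigIntegral.harmonicOp_eq {N : ℕ} {m : ℂ} {p : PolyC N} {D : Module.End ℂ (RatFun N)}
    (h : IsTrigIntegral m p D) :
    harmonicOp m p.totalDegree D = locExp (halfComm (opL N m)) D :=
  harmonicOp_eq_locExp h.halfComm_pow_eq_zero

theorem exists_isTrigIntegral_powerSum {N : ℕ} (m : ℂ) (k : ℕ) :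
    ∃ D : Module.End ℂ (RatFun N), IsTrigIntegral m (MvPolynomial.psum (Fin N) ℂ k) D ∧
      IsRes m (∑ i : Fin N, Hpi m i ^ k) D := by
  obtain ⟨D, hD⟩ := exists_isRes (algT_le_invariantSubalgebra N m
    (Algebra.subset_adjoin ⟨k, rfl⟩ : ∑ i : Fin N, Hpi m i ^ k ∈ algT N m))
  exact ⟨D, ⟨_, isOrdering_powerSum N k, by rwa [evalPi_powerSum]⟩, hD⟩

theorem exists_algDT {N : ℕ} {m : ℂ} {t : Cherednik N m} (ht : t ∈ algT N m) :
    ∃ D ∈ algDT N m, IsRes m t D := by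
  have hinv := fun {a} (ha : a ∈ algT N m) => algT_le_invariantSubalgebra N m ha
  induction ht using Algebra.adjoin_induction with
  | mem t ht =>
    obtain ⟨k, rfl⟩ := ht
    obtain ⟨D, h1, h2⟩ := exists_isTrigIntegral_powerSum (N := N) m k
    exact ⟨D, Algebra.subset_adjoin ⟨_, psum_mem_symPoly N k, h1⟩, h2⟩
  | algebraMap r => exact ⟨_, algebraMap_mem _ r, isRes_algebraMap m r⟩
  | add a b ha hb iha ihb =>
    obtain ⟨D, h1, h2⟩ := iha
    obtain ⟨E, h3, h4⟩ := ihb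
    exact ⟨D + E, add_mem h1 h3, h2.add (hinv ha) (hinv hb) h4⟩
  | mul a b ha hb iha ihb =>
    obtain ⟨D, h1, h2⟩ := iha
    obtain ⟨E, h3, h4⟩ := ihb
    exact ⟨D * E, mul_mem h1 h3, h2.mul (hinv ha) (hinv hb) h4⟩

/-- This is the surjectivity of `Res` on `𝒯`. It also gives the local nilpotency of `½[·, L]` on all
of `algDT`. -/
theorem exists_algT_of_mem_algDT {N : ℕ} {m : ℂ} {D : Module.End ℂ (RatFun N)}
    (hD : D ∈ algDT N m) : ∃ t ∈ algT N m, IsRes m t D := by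
  have hinv := fun {a} (ha : a ∈ algT N m) => algT_le_invariantSubalgebra N m ha
  induction hD using Algebra.adjoin_induction with
  | mem D hD =>
    obtain ⟨p, _, h⟩ := hD
    exact h.exists_algT
  | algebraMap r => exact ⟨_, algebraMap_mem _ r, isRes_algebraMap m r⟩
  | add D E _ _ ihD ihE =>
    obtain ⟨a, h1, h2⟩ := ihD
    obtain ⟨b, h3, h4⟩ := ihE
    exact ⟨a + b, add_mem h1 h3, h2.add (hinv h1) (hinv h3) h4⟩
  | mul D E _ _ ihD ihE =>
    obtain ⟨a, h1, h2⟩ := ihD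
    obtain ⟨b, h3, h4⟩ := ihE
    exact ⟨a * b, mul_mem h1 h3, h2.mul (hinv h1) (hinv h3) h4⟩

/-! ### The homomorphism `φ_LN` and the commutative square -/

theorem algDT_locNilpotent {N : ℕ} {m : ℂ} {D : Module.End ℂ (RatFun N)} (hD : D ∈ algDT N m) :
    LocNilpotent (halfComm (opL N m)) D := by
  obtain ⟨t, ht, h⟩ := exists_algT_of_mem_algDT hD
  exact (h.gammaAut (algT_le_invariantSubalgebra N m ht)).1

theorem locExp_halfComm_mul {N : ℕ} {m : ℂ} {D E : Module.End ℂ (RatFun N)}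
    (hD : D ∈ algDT N m) (hE : E ∈ algDT N m) :
    locExp (halfComm (opL N m)) (D * E) =
      locExp (halfComm (opL N m)) D * locExp (halfComm (opL N m)) E :=
  locExp_bilinear (halfComm_mul (opL N m)) (algDT_locNilpotent hD) (algDT_locNilpotent hE)

theorem locExp_halfComm_algebraMap {A : Type*} [Ring A] [Algebra ℂ A] (a : A) (r : ℂ) :
    locExp (halfComm a) (algebraMap ℂ A r) = algebraMap ℂ A r :=
  locExp_of_apply_eq_zero (by rw [halfComm_apply, Algebra.commutes, sub_self, smul_zero])

theorem locExp_halfComm_mem_algDR {N : ℕ} {m : ℂ} {D : Module.End ℂ (RatFun N)}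
    (hD : D ∈ algDT N m) : locExp (halfComm (opL N m)) D ∈ algDR N m := by
  induction hD using Algebra.adjoin_induction with
  | mem D hD =>
    obtain ⟨p, hp, h⟩ := hD
    exact Algebra.subset_adjoin ⟨p, hp, D, h, h.harmonicOp_eq.symm⟩
  | algebraMap r => rw [locExp_halfComm_algebraMap]; exact algebraMap_mem _ r
  | add D E hD hE ihD ihE =>
    rw [locExp_add (algDT_locNilpotent hD) (algDT_locNilpotent hE)]
    exact add_mem ihD ihE
  | mul D E hD hE ihD ihE =>
    rw [locExp_halfComm_mul hD hE]
    exact mul_mem ihD ihE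

/-- The homomorphism `φ_{LN}`: conjugation by `e^{L/2}`. -/
def phiLN (N : ℕ) (m : ℂ) : algDT N m →ₐ[ℂ] algDR N m where
  toFun D := ⟨locExp (halfComm (opL N m)) (D : Module.End ℂ (RatFun N)),
    locExp_halfComm_mem_algDR D.2⟩
  map_mul' D E := Subtype.ext (locExp_halfComm_mul D.2 E.2)
  map_add' D E := Subtype.ext (locExp_add (algDT_locNilpotent D.2) (algDT_locNilpotent E.2))
  map_one' := Subtype.ext (by simpa using locExp_halfComm_algebraMap (opL N m) 1)
  map_zero' := Subtype.ext (by simpa using locExp_halfComm_algebraMap (opL N m) 0)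
  commutes' r := Subtype.ext (locExp_halfComm_algebraMap (opL N m) r)

theorem coe_phiLN {N : ℕ} {m : ℂ} (D : algDT N m) :
    (phiLN N m D : Module.End ℂ (RatFun N)) = locExp (halfComm (opL N m)) D := rfl

theorem phiLN_surjective (N : ℕ) (m : ℂ) : Function.Surjective (phiLN N m) := by
  rintro ⟨D', hD'⟩
  suffices h : ∃ D : algDT N m, (phiLN N m D : Module.End ℂ (RatFun N)) = D' from
    let ⟨D, hD⟩ := h
    ⟨D, Subtype.ext hD⟩
  induction hD' using Algebra.adjoin_induction with
  | mem D' h =>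
    obtain ⟨p, hp, D, h, rfl⟩ := h
    exact ⟨⟨D, Algebra.subset_adjoin ⟨p, hp, h⟩⟩, h.harmonicOp_eq.symm⟩
  | algebraMap r => exact ⟨algebraMap ℂ _ r, by rw [AlgHom.commutes]; rfl⟩
  | add _ _ _ _ ihD ihE =>
    obtain ⟨D, rfl⟩ := ihD
    obtain ⟨E, rfl⟩ := ihE
    exact ⟨D + E, by rw [map_add]; rfl⟩
  | mul _ _ _ _ ihD ihE =>
    obtain ⟨D, rfl⟩ := ihD
    obtain ⟨E, rfl⟩ := ihE
    exact ⟨D * E, by rw [map_mul]; rfl⟩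

theorem resHom_algT_mem {N : ℕ} {m : ℂ} (t : algT N m) :
    resHom N m ⟨t, algT_le_invariantSubalgebra N m t.2⟩ ∈ algDT N m := by
  obtain ⟨D, hD, h⟩ := exists_algDT t.2
  rwa [← h.eq_resHom]

/-- An element of `ℛ` is `γ(t)`, and its restriction is the exponential of `½[·, L]` at `Res t`. -/
theorem resHom_algR_mem {N : ℕ} {m : ℂ} (r : algR N m) :
    resHom N m ⟨r, algR_le_invariantSubalgebra N m r.2⟩ ∈ algDR N m := by
  obtain ⟨r, t, ht, rfl⟩ := r
  obtain ⟨D, hD, h⟩ := exists_algDT ht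
  have h' := (h.gammaAut (algT_le_invariantSubalgebra N m ht)).2
  have e : resHom N m ⟨gammaAut N m t, _⟩ = _ :=
    (h'.eq_resHom (gammaAut_mem_invariantSubalgebra (algT_le_invariantSubalgebra N m ht))).symm
  change resHom N m ⟨gammaAut N m t, _⟩ ∈ algDR N m
  rw [e]
  exact locExp_halfComm_mem_algDR hD

/-- The homomorphism `Res : 𝒯 → 𝒟_CM^T`. -/
def resAlgT (N : ℕ) (m : ℂ) : algT N m →ₐ[ℂ] algDT N m :=
  ((resHom N m).comp (Subalgebra.inclusion (algT_le_invariantSubalgebra N m))).codRestrict _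
    resHom_algT_mem

/-- The homomorphism `Res : ℛ → 𝒟_CM^R`. -/
def resAlgR (N : ℕ) (m : ℂ) : algR N m →ₐ[ℂ] algDR N m :=
  ((resHom N m).comp (Subalgebra.inclusion (algR_le_invariantSubalgebra N m))).codRestrict _
    resHom_algR_mem

theorem isRes_resAlgT {N : ℕ} {m : ℂ} (t : algT N m) :
    IsRes m (t : Cherednik N m) (resAlgT N m t : Module.End ℂ (RatFun N)) :=
  isRes_resHom ⟨t, algT_le_invariantSubalgebra N m t.2⟩

theorem isRes_resAlgR {N : ℕ} {m : ℂ} (r : algR N m) :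
    IsRes m (r : Cherednik N m) (resAlgR N m r : Module.End ℂ (RatFun N)) :=
  isRes_resHom ⟨r, algR_le_invariantSubalgebra N m r.2⟩

theorem resAlgT_surjective (N : ℕ) (m : ℂ) : Function.Surjective (resAlgT N m) := by
  intro D
  obtain ⟨t, ht, h⟩ := exists_algT_of_mem_algDT D.2
  exact ⟨⟨t, ht⟩, Subtype.ext ((isRes_resAlgT ⟨t, ht⟩).unique h)⟩

/-- Both sides at `t` are restrictions of `γ(t)`, hence equal by uniqueness. -/
theorem resAlgR_comp_gammaAut (N : ℕ) (m : ℂ) :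
    (resAlgR N m).comp ((gammaAut N m).subalgebraMap (algT N m)).toAlgHom =
      (phiLN N m).comp (resAlgT N m) := by
  ext1 t
  refine Subtype.ext ?_
  have h := ((isRes_resAlgT t).gammaAut (algT_le_invariantSubalgebra N m t.2)).2
  exact (isRes_resAlgR ((gammaAut N m).subalgebraMap (algT N m) t)).unique h

/-- In the commutative square the composite through `algDT` is surjective, so its last factor on the
other side is too. -/
theorem resAlgR_surjective (N : ℕ) (m : ℂ) : Function.Surjective (resAlgR N m) := by
  have h : Function.Surjective ((resAlgR N m).comp
      ((gammaAut N m).subalgebraMap (algT N m)).toAlgHom) := by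
    rw [resAlgR_comp_gammaAut]
    exact (phiLN_surjective N m).comp (resAlgT_surjective N m)
  exact Function.Surjective.of_comp h

end

end LassalleNekrasov

/-! ### Assembly of the proposition -/

theorem proposition6p3 (N : ℕ) (m : ℂ) :
    -- the restriction is well defined on the elements of `H_m` commuting with `S_N`
    (∀ h : Cherednik N m,
      (∀ w : Equiv.Perm (Fin N),
        Hw m w * h = h * Hw m w) →
      ∃! D : Module.End ℂ (RatFun N), IsRes m h D) ∧
    -- every symmetric polynomial has an ordering, and every ordering defines an operator `𝓛_p`
    (∀ p ∈ symPoly N,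
      (∃ P : FreeAlgebra ℂ (Fin N), IsOrdering p P) ∧
      ∀ P : FreeAlgebra ℂ (Fin N), IsOrdering p P →
        ∃! D : Module.End ℂ (RatFun N),
          IsRes m (evalPi m P) D) ∧
    -- `𝒯` is commutative, and `ℛ = γ(𝒯)` is generated by the elements `∑ (x_i y_i - y_i^2)^k`
    (∀ a ∈ algT N m, ∀ b ∈ algT N m, a * b = b * a) ∧
    algR N m =
      Algebra.adjoin ℂ (Set.range fun k : ℕ => ∑ i : Fin N,
        (Hx m i * Hy m i - Hy m i ^ 2) ^ k) ∧
    -- the commutative diagram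
    (∃ (resT : algT N m →ₐ[ℂ] algDT N m)
       (resR : algR N m →ₐ[ℂ] algDR N m)
       (φ : algDT N m →ₐ[ℂ] algDR N m),
      (∀ t : algT N m, IsRes m (t : Cherednik N m)
        (resT t : Module.End ℂ (RatFun N))) ∧
      (∀ r : algR N m, IsRes m (r : Cherednik N m)
        (resR r : Module.End ℂ (RatFun N))) ∧
      Function.Surjective resT ∧ Function.Surjective resR ∧
      (∀ p ∈ symPoly N, ∀ D : algDT N m,
        IsTrigIntegral m p (D : Module.End ℂ (RatFun N)) →
        (φ D : Module.End ℂ (RatFun N)) =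
          harmonicOp m p.totalDegree
            (D : Module.End ℂ (RatFun N))) ∧
      resR.comp ((gammaAut N m).subalgebraMap
          (algT N m)).toAlgHom =
        φ.comp resT) ∧
    -- `𝓛_p^ℋ = e^{-L/2} 𝓛_p e^{L/2}` wherever `L` is locally nilpotent, in particular on `Λ_N`
    (∀ q ∈ symPoly N, LocNilpotent
      (opL N m)
      (algebraMap (PolyC N) (RatFun N) q)) ∧
    (∀ p ∈ symPoly N, ∀ D : Module.End ℂ (RatFun N),
      IsTrigIntegral m p D →
      ∀ f : RatFun N,
        LocNilpotent (opL N m) f →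
        LocNilpotent (opL N m) (D f) ∧
        harmonicOp m p.totalDegree D f =
          locExp (-(1 / 2 : ℂ) • opL N m)
            (D (locExp ((1 / 2 : ℂ) • opL N m) f))) := by
  refine ⟨fun h hh => existsUnique_isRes (mem_invariantSubalgebra.mpr hh),
    fun p hp => ⟨exists_isOrdering hp, fun P hP =>
      existsUnique_isRes (evalPi_mem_invariantSubalgebra m hP.invariant)⟩,
    fun a ha b hb => algT_comm m ha hb, algR_eq_adjoin N m,
    ⟨resAlgT N m, resAlgR N m, phiLN N m, isRes_resAlgT, isRes_resAlgR, resAlgT_surjective N m,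
      resAlgR_surjective N m, fun p _ D hD => ?_, resAlgR_comp_gammaAut N m⟩,
    fun q hq => locNilpotent_opL_symPoly m hq, fun p _ D hD f hf => ?_⟩
  · rw [coe_phiLN, hD.harmonicOp_eq]
  · have hnil : LocNilpotent (halfComm (opL N m)) D := ⟨_, hD.halfComm_pow_eq_zero⟩
    exact ⟨hnil.apply_of_halfComm hf, by rw [hD.harmonicOp_eq, locExp_halfComm_apply hnil hf]⟩
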